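/- **Setting.** Let $d$ be odd, and let labels $n,k,p$ range over the integers in $[-\frac{d-1}{2},\frac{d-1}{2}]$. On $\mathbb C^d$ with orthonormal energy basis $|n\rangle$ put $\hat H_d=\frac{2\pi}{\sqrt d}\sum_n n|n\rangle\langle n|$ and $|\theta_k\rangle=\frac1{\sqrt d}\sum_n e^{-2\pi i kn/d}|n\rangle$. Let $\theta_3(z,\tau)=\sum_{m\in\mathbb Z}e^{i\pi\tau m^2+2\pi i mz}$. For $\xi>0$ and $n_0\in\mathbb Z$ the clock starts in the quasi-ideal state $$|\Psi_0\rangle=\sum_k\psi(k)|\theta_k\rangle,\qquad \psi(k)=\frac{\sqrt{2/d}\;\theta_3\!\left(\frac kd,\frac{i\xi^2}{d}\right)e^{2\pi i n_0k/d}}{\sqrt{\theta_3\!\left(0,\frac{i\xi^2}{2d}\right)\theta_3\!\left(0,\frac{id\xi^2}{2}\right)+\theta_3\!\left(\frac12,\frac{i\xi^2}{2d}\right)\theta_3\!\left(\frac d2,\frac{id\xi^2}{2}\right)}} .$$ It is measured $J$ times with Kraus operators ($|\widetilde\xi|\le\frac{\sqrt d}{2}$) $$\hat\Omega(\widetilde\xi)=\frac{1}{d^{1/4}\sqrt{\theta_3(0,2i\sigma_m^2/d)}}\sum_k\theta_3\!\left(\frac{k-\widetilde\xi\sqrt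 d}{d},\frac{i\sigma_m^2}{d}\right)|\theta_k\rangle\langle\theta_k| ,$$ each measurement being preceded by free evolution $U=e^{-i\hat H_d\delta/\sqrt d}$ with $\delta=\frac12$. The outcomes $(\widetilde\xi_1,\dots,\widetilde\xi_J)\in[-\frac{\sqrt d}{2},\frac{\sqrt d}{2}]^J$ have joint density $\|\hat\Omega(\widetilde\xi_J)U\cdots\hat\Omega(\widetilde\xi_1)U|\Psi_0\rangle\|^2$, and $\langle\cdot\rangle$ is the expectation with respect to it. Let $\mathbf E^{p_1}$ be the expectation for the random walk $p_1,p_2,\dots$ on $\mathbb Z/d$ started at $p_1$ whose jumps are independent with distribution $q\mapsto\theta_3(\frac qd,\frac{i}{2\sigma_m^2d})\big/\big(\sqrt{2\sigma_m^2d}\,\theta_3(0,\frac{2i\sigma_m^2}{d})\big)$. **Statement.** Let $c_2>0$, let $\sigma_m^2=c_2d^\beta$, and for $t>0$ let $I=\lceil t\sqrt d\rceil$. 1. For every $c_3\in[0,2]$ there is a constant $c_5>0$, depending only on $c_2,c_3$, such that for all $t>0$, $\beta<-\frac12$ and $\varepsilon>0$, as $d\to\infty$ through odd integers, uniformly in the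 starting point $p_1$, $$\mathbf E^{p_1}\Big[\prod_{1\le k\le I}\big(1-c_3\mathbf 1_{p_k=\frac{d-1}{2}}\big)\Big]\le 1-(1-\varepsilon)\frac{c_3\,t}{\sqrt d}\,(1+g_d+h_d),$$ where $g_d=\mathcal O\big(d^{3/2}e^{-\frac{\pi\varepsilon t}{2c_2}d^{-1/2-\beta}}\big)$, $h_d=\mathcal O\big(e^{-c_5d^{||\beta|-1|}}\big)$ and $h_d=o(1)$. 2. For all $t>0$, $\beta<-\frac12$, $c_1>0$ and $-1<\alpha<1$, with $\xi^2=c_1d^\alpha$, as $d\to\infty$ through odd integers, $$\left|\left\langle\exp\left(\frac{2\pi i\,\widetilde\xi_I}{\sqrt d}\right)\right\rangle\right|\le 1-\frac{t}{\sqrt d}\,(1+o(1)),$$ uniformly in $n_0\in\mathbb Z$ and in the total number $J\ge I$ of measurements. -/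

import Mathlib

open Filter Topology Asymptotics

namespace QuasiIdealClock

noncomputable section

/-- The Jacobi function `θ₃(z, i s) = ∑_{m ∈ ℤ} exp(-π s m² + 2 π i m z)` for real `z` and `s > 0`,
as a real number (see `theta3_eq`). -/
def theta3 (z s : ℝ) : ℝ := (jacobiTheta₂ (z : ℂ) (Complex.I * (s : ℂ))).re

/-- For real arguments the theta function is real, so taking the real part loses nothing. -/
theorem theta3_eq (z s : ℝ) :
    (theta3 z s : ℂ) = jacobiTheta₂ (z : ℂ) (Complex.I * (s : ℂ)) := by
  have h : (starRingEnd ℂ) (jacobiTheta₂ (z : ℂ) (Complex.I * (s : ℂ)))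
      = jacobiTheta₂ (z : ℂ) (Complex.I * (s : ℂ)) := by
    rw [jacobiTheta₂_conj]
    simp
  exact Complex.conj_eq_iff_re.mp h

/-- The labels `-(d-1)/2, …, (d-1)/2` of the energy basis and of the time basis (`d` odd). -/
abbrev Idx (d : ℕ) : Type :=
  {n : ℤ // n ∈ Finset.Icc (-(((d : ℤ) - 1) / 2)) (((d : ℤ) - 1) / 2)}

/-- Coordinates of the time eigenstate `|θ_k⟩ = d^{-1/2} ∑_n e^{-2πikn/d} |n⟩` in the energy
basis. Vectors and matrices below are always written in the energy basis `|n⟩`. -/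
def timeState (d : ℕ) (k : Idx d) : Idx d → ℂ := fun n =>
  (1 / (Real.sqrt d : ℂ)) *
    Complex.exp (-(2 * Real.pi * Complex.I * ((k : ℤ) : ℂ) * ((n : ℤ) : ℂ) / (d : ℂ)))

/-- The Hamiltonian `(2π/√d) ∑_n n |n⟩⟨n|`. -/
def hamiltonian (d : ℕ) : Matrix (Idx d) (Idx d) ℂ :=
  Matrix.diagonal fun n => ((2 * Real.pi / Real.sqrt d * ((n : ℤ) : ℝ) : ℝ) : ℂ)

/-- The free evolution `exp(-i τ H)` during the time `τ`. -/
def evolution (d : ℕ) (τ : ℝ) : Matrix (Idx d) (Idx d) ℂ :=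
  NormedSpace.exp ((-(Complex.I * (τ : ℂ))) • hamiltonian d)

/-- The amplitude `ψ(k) = 𝒩 θ₃(k/d, i ξ²/d) e^{2πi n₀ k/d}` of the quasi-ideal state of squared
width `ξ² = ξsq` and mean energy label `n₀`, with
`𝒩 = √(2/d) / √(θ₃(0, iξ²/(2d)) θ₃(0, idξ²/2) + θ₃(1/2, iξ²/(2d)) θ₃(d/2, idξ²/2))`. -/
def amplitude (d : ℕ) (ξsq : ℝ) (n₀ : ℤ) (k : Idx d) : ℂ :=
  ((Real.sqrt (2 / d) /
      Real.sqrt (theta3 0 (ξsq / (2 * d)) * theta3 0 (d * ξsq / 2)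
        + theta3 (1 / 2) (ξsq / (2 * d)) * theta3 (d / 2) (d * ξsq / 2))
    * theta3 (((k : ℤ) : ℝ) / d) (ξsq / d) : ℝ) : ℂ)
  * Complex.exp (2 * Real.pi * Complex.I * (n₀ : ℂ) * ((k : ℤ) : ℂ) / (d : ℂ))

/-- The initial state `|Ψ₀⟩ = ∑_k ψ(k) |θ_k⟩`. -/
def initialState (d : ℕ) (ξsq : ℝ) (n₀ : ℤ) : Idx d → ℂ :=
  ∑ k : Idx d, amplitude d ξsq n₀ k • timeState d k

/-- The coefficient `Ω_k(x) = d^{-1/4} θ₃(0, 2iσ²/d)^{-1/2} θ₃((k - x√d)/d, iσ²/d)` of the Kraus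
operator, where `σ² = σsq`. -/
def krausCoeff (d : ℕ) (σsq : ℝ) (x : ℝ) (k : Idx d) : ℝ :=
  1 / Real.sqrt (theta3 0 (2 * σsq / d)) * (1 / (d : ℝ) ^ (1 / 4 : ℝ))
    * theta3 ((((k : ℤ) : ℝ) - x * Real.sqrt d) / d) (σsq / d)

/-- The Kraus operator `Ω(x) = ∑_k Ω_k(x) |θ_k⟩⟨θ_k|` for the outcome `x`. -/
def kraus (d : ℕ) (σsq : ℝ) (x : ℝ) : Matrix (Idx d) (Idx d) ℂ :=
  ∑ k : Idx d, (krausCoeff d σsq x k : ℂ) •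
    Matrix.vecMulVec (timeState d k) (star (timeState d k))

/-- The unnormalised state `Ω(x_J) U ⋯ Ω(x_1) U |Ψ₀⟩` after `J` measurements with outcomes
`x_1, …, x_J`, where `U` is the evolution during the time `δ/√d`. -/
def postState (d : ℕ) (ξsq σsq δ : ℝ) (n₀ : ℤ) : (J : ℕ) → (Fin J → ℝ) → (Idx d → ℂ)
  | 0, _ => initialState d ξsq n₀
  | J + 1, x =>
      (kraus d σsq (x (Fin.last J))).mulVec
        ((evolution d (δ / Real.sqrt d)).mulVec
          (postState d ξsq σsq δ n₀ J (fun j => x j.castSucc)))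

/-- The joint density of the outcomes of `J` measurements on `[-√d/2, √d/2]^J`. -/
def outcomeDensity (d : ℕ) (ξsq σsq δ : ℝ) (n₀ : ℤ) (J : ℕ) (x : Fin J → ℝ) : ℝ :=
  ‖WithLp.toLp 2 (postState d ξsq σsq δ n₀ J x)‖ ^ 2

/-- The expectation `⟨exp(2πi x_i/√d)⟩` for the `i`-th outcome in a sequence of `J` measurements. -/
def outcomeCharacter (d : ℕ) (ξsq σsq δ : ℝ) (n₀ : ℤ) (J : ℕ) (i : Fin J) : ℂ :=
  ∫ x in Set.pi Set.univ
      (fun _ : Fin J => Set.Icc (-(Real.sqrt d / 2)) (Real.sqrt d / 2)),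
    Complex.exp (2 * Real.pi * Complex.I * (x i : ℂ) / (Real.sqrt d : ℂ))
      * (outcomeDensity d ξsq σsq δ n₀ J x : ℂ)

/-- The jump distribution `q ↦ θ₃(q/d, i/(2σ²d)) / (√(2σ²d) θ₃(0, 2iσ²/d))` of the random walk
on the ring of integers modulo `d`. -/
def jumpProb (d : ℕ) (σsq : ℝ) (q : ℤ) : ℝ :=
  theta3 ((q : ℝ) / d) (1 / (2 * σsq * d)) /
    (Real.sqrt (2 * σsq * d) * theta3 0 (2 * σsq / d))

/-- The expectation `E^{p₁}[F(p_1, …, p_{n+1})]` for the walk with `n` jumps started at `p₁`;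
the positions `p_1, …, p_{n+1}` are `p 0, …, p n`. -/
def walkExpectation (d : ℕ) (σsq : ℝ) (n : ℕ) (p₁ : Idx d)
    (F : (Fin (n + 1) → Idx d) → ℝ) : ℝ :=
  ∑ p : Fin (n + 1) → Idx d,
    if p 0 = p₁ then
      (∏ j : Fin n, jumpProb d σsq ((p j.succ : ℤ) - (p j.castSucc : ℤ))) * F p
    else 0

/-- The random variable `∏_j (1 - c 1_{p_j = (d-1)/2})`. -/
def antipodeProduct (d : ℕ) (c : ℝ) (n : ℕ) (p : Fin (n + 1) → Idx d) : ℝ :=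
  ∏ j : Fin (n + 1), (1 - c * (if (p j : ℤ) = ((d : ℤ) - 1) / 2 then 1 else 0))

end

end QuasiIdealClock

/-!
In the Heisenberg picture everything reduces to a walk on the energy labels. A Kraus operator is a
superposition of cyclic energy shifts with Gaussian coefficients, so averaging over the outcome
turns an observable `S G`, with `S` the cyclic shift and `G` diagonal in energy, into `S (P G)`,
where `P` is the transition matrix of the walk (Parseval), and averaging `exp(2πi ξ̃/√d)` yields a
multiple of `S` by a factor in `[0, 1]`. Conjugation by the evolution for `δ = 1/2` multiplies `S`
by a phase, except at the label where `S` wraps around, where an additional sign appears: this is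
the factor `1 - 2 · 1_{p = (d-1)/2}`. Hence `|⟨exp(2πi ξ̃_I/√d)⟩|` is at most the largest
expectation, over the starting points, of the product of these factors along the walk.

Telescoping `1 - ∏ (1 - c 1_{p_k = a})` over the visits of `a`, and bounding from below the
expectation of the factors that follow a visit by `1 - c ρ`, where `ρ` bounds the expected number of
visits of the walk started at `a`, gives `1 - E ∏ ≥ c (1 - c ρ) V` with `V` the expected number of
visits. Poisson summation identifies the eigenvalues of the transition matrix as Gaussian weights.
As `β < -1/2`, the resulting spectral gap makes the walk equidistribute in `o(√d)` steps, so that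
`V ≥ (1 - ε) t/√d`, while the uniform bound on the jump probabilities gives `ρ → 0`.
-/

namespace QuasiIdealClock

open Real
open scoped FourierTransform Matrix ComplexConjugate

noncomputable section

section FourierCharacter

theorem fourierChar_intCast (n : ℤ) : 𝐞 (n : ℝ) = 1 :=
  Circle.exp_two_pi_mul_int n

theorem fourierChar_add_intCast (x : ℝ) (n : ℤ) : 𝐞 (x + n) = 𝐞 x := by
  rw [AddChar.map_add_eq_mul, fourierChar_intCast, mul_one]

theorem fourierChar_eq_one_iff (x : ℝ) : 𝐞 x = 1 ↔ ∃ n : ℤ, x = n := by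
  rw [← Circle.coe_eq_one, fourierChar_apply, Complex.exp_eq_one_iff]
  refine exists_congr fun n => ?_
  rw [← mul_assoc, mul_left_inj' Complex.I_ne_zero, mul_comm (n : ℂ)]
  norm_cast
  exact mul_right_inj' two_pi_pos.ne'

theorem coe_fourierChar_add (x y : ℝ) : (𝐞 (x + y) : ℂ) = 𝐞 x * 𝐞 y := by
  rw [AddChar.map_add_eq_mul, Circle.coe_mul]

theorem conj_fourierChar (x : ℝ) : conj (𝐞 x : ℂ) = 𝐞 (-x) := by
  rw [AddChar.map_neg_eq_inv, Circle.coe_inv_eq_conj]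

theorem fourierChar_div_eq_one_iff {d : ℕ} (hd : d ≠ 0) (r : ℤ) :
    𝐞 ((r : ℝ) / d) = 1 ↔ (d : ℤ) ∣ r := by
  rw [fourierChar_eq_one_iff]
  refine exists_congr fun n => ?_
  rw [div_eq_iff (Nat.cast_ne_zero.mpr hd), mul_comm]
  norm_cast

theorem fourierChar_div_congr {d : ℕ} (hd : d ≠ 0) {m n : ℤ} (h : (d : ℤ) ∣ m - n) :
    𝐞 ((m : ℝ) / d) = 𝐞 ((n : ℝ) / d) := by
  have hquot := (fourierChar_div_eq_one_iff hd (m - n)).mpr h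
  rw [Int.cast_sub, sub_div, AddChar.map_sub_eq_div] at hquot
  exact div_eq_one.mp hquot

end FourierCharacter

section Theta

/-- The Gaussian weight `exp(-π s m²)`, the `m`-th Fourier coefficient of `z ↦ θ₃(z, i s)`. -/
def gaussWeight (s : ℝ) (m : ℤ) : ℝ := rexp (-(π * s * (m : ℝ) ^ 2))

theorem gaussWeight_pos (s : ℝ) (m : ℤ) : 0 < gaussWeight s m := exp_pos _

theorem gaussWeight_sq (s : ℝ) (m : ℤ) : gaussWeight s m ^ 2 = gaussWeight (2 * s) m := by
  rw [gaussWeight, gaussWeight, ← exp_nat_mul]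
  congr 1
  push_cast
  ring

theorem jacobiTheta₂_term_I_mul (z s : ℝ) (m : ℤ) :
    jacobiTheta₂_term m z (Complex.I * s) = gaussWeight s m * 𝐞 (m * z) := by
  rw [jacobiTheta₂_term, gaussWeight, fourierChar_apply, Complex.ofReal_exp, ← Complex.exp_add]
  congr 1
  push_cast
  linear_combination (π * (m : ℂ) ^ 2 * s) * Complex.I_sq

theorem hasSum_theta3 {s : ℝ} (hs : 0 < s) (z : ℝ) :
    HasSum (fun m : ℤ => (gaussWeight s m : ℂ) * 𝐞 (m * z)) (theta3 z s) := by
  rw [theta3_eq]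
  simpa only [jacobiTheta₂_term_I_mul] using
    hasSum_jacobiTheta₂_term (z : ℂ) (τ := Complex.I * s) (by simpa using hs)

theorem hasSum_theta3_zero {s : ℝ} (hs : 0 < s) : HasSum (gaussWeight s) (theta3 0 s) := by
  rw [← Complex.hasSum_ofReal]
  simpa using hasSum_theta3 hs 0

theorem summable_gaussWeight {s : ℝ} (hs : 0 < s) : Summable (gaussWeight s) :=
  (hasSum_theta3_zero hs).summable

theorem one_le_theta3_zero {s : ℝ} (hs : 0 < s) : 1 ≤ theta3 0 s := by
  rw [← (hasSum_theta3_zero hs).tsum_eq]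
  simpa [gaussWeight] using
    (summable_gaussWeight hs).le_tsum 0 fun m _ => (gaussWeight_pos s m).le

theorem theta3_le_theta3_zero {s : ℝ} (hs : 0 < s) (z : ℝ) : theta3 z s ≤ theta3 0 s := by
  refine le_of_abs_le ?_
  rw [← norm_eq_abs, ← Complex.norm_real]
  refine (hasSum_theta3 hs z).norm_le_of_bounded (hasSum_theta3_zero hs) fun m => ?_
  simp [abs_of_pos (gaussWeight_pos s m), Circle.norm_coe]

theorem sqrt_mul_theta3 {s : ℝ} (hs : 0 < s) (z : ℝ) :
    ((√s * theta3 z s : ℝ) : ℂ) =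
      Complex.exp (-(π * z ^ 2 / s)) *
        jacobiTheta₂ (z / (Complex.I * s)) (-1 / (Complex.I * s)) := by
  have hs' : (s : ℂ) ≠ 0 := by exact_mod_cast hs.ne'
  have hsqrt : (-Complex.I * (Complex.I * s)) ^ (1 / 2 : ℂ) = (√s : ℂ) := by
    rw [← mul_assoc, neg_mul, Complex.I_mul_I, neg_neg, one_mul, sqrt_eq_rpow,
      Complex.ofReal_cpow hs.le]
    norm_num
  have hsqrt_ne : (√s : ℂ) ≠ 0 := by exact_mod_cast (sqrt_pos.mpr hs).ne'
  have hexponent : -π * Complex.I * (z : ℂ) ^ 2 / (Complex.I * s) = -(π * z ^ 2 / s) := by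
    field_simp
  rw [Complex.ofReal_mul, theta3_eq, jacobiTheta₂_functional_equation, hsqrt, hexponent]
  field_simp

theorem hasSum_sqrt_mul_theta3 {s : ℝ} (hs : 0 < s) (z : ℝ) :
    HasSum (fun j : ℤ => rexp (-(π * (z + j) ^ 2 / s))) (√s * theta3 z s) := by
  have hs' : (s : ℂ) ≠ 0 := by exact_mod_cast hs.ne'
  have him : 0 < (-1 / (Complex.I * s) : ℂ).im := by
    have hdual_point : (-1 / (Complex.I * s) : ℂ) = ((1 / s : ℝ) : ℂ) * Complex.I := by
      push_cast
      field_simp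
      exact Complex.I_sq.symm
    rw [hdual_point]
    simpa using hs
  rw [← Complex.hasSum_ofReal, sqrt_mul_theta3 hs]
  have hdual := (hasSum_jacobiTheta₂_term ((z : ℂ) / (Complex.I * s)) him).mul_left
    (Complex.exp (-(π * z ^ 2 / s)))
  refine ((Equiv.neg ℤ).hasSum_iff.mpr hdual).congr_fun fun j => ?_
  simp only [Function.comp, Equiv.neg_apply, jacobiTheta₂_term]
  rw [← Complex.exp_add, Complex.ofReal_exp]
  congr 1
  push_cast
  field_simp
  ring

theorem theta3_pos {s : ℝ} (hs : 0 < s) (z : ℝ) : 0 < theta3 z s := by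
  have hsum := hasSum_sqrt_mul_theta3 hs z
  refine pos_of_mul_pos_right ?_ (sqrt_nonneg s)
  rw [← hsum.tsum_eq]
  exact hsum.summable.tsum_pos (fun j => (exp_pos _).le) 0 (exp_pos _)

theorem sqrt_mul_theta3_zero {s : ℝ} (hs : 0 < s) : √s * theta3 0 s = theta3 0 (1 / s) := by
  refine (hasSum_sqrt_mul_theta3 hs 0).unique ?_
  convert hasSum_theta3_zero (one_div_pos.mpr hs) using 2 with j
  simp only [gaussWeight]
  congr 1
  ring

theorem theta3_zero_le_theta3_zero {s t : ℝ} (hs : 0 < s) (hst : s ≤ t) :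
    theta3 0 t ≤ theta3 0 s := by
  refine hasSum_le (fun j => ?_) (hasSum_theta3_zero (hs.trans_le hst)) (hasSum_theta3_zero hs)
  simp only [gaussWeight]
  gcongr

theorem theta3_zero_one_div_le {s : ℝ} (hs : 0 < s) :
    theta3 0 (1 / s) ≤ theta3 0 1 * (1 + √s) := by
  have hθ := one_le_theta3_zero one_pos
  rcases le_total s 1 with h | h
  · have hmono := theta3_zero_le_theta3_zero one_pos (one_le_one_div hs h)
    nlinarith [sqrt_nonneg s]
  · rw [← sqrt_mul_theta3_zero hs]
    have hmono := theta3_zero_le_theta3_zero one_pos h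
    nlinarith [sqrt_nonneg s]

theorem continuous_theta3 {s : ℝ} (hs : 0 < s) : Continuous fun z => theta3 z s := by
  refine Complex.continuous_re.comp (continuous_iff_continuousAt.mpr fun z => ?_)
  exact (differentiableAt_jacobiTheta₂_fst (z : ℂ) (τ := Complex.I * s)
    (by simpa using hs)).continuousAt.comp Complex.continuous_ofReal.continuousAt

end Theta

section Labels

variable {d : ℕ}

/-- The label congruent to `n` modulo `d`. -/
def wrap (hd : Odd d) (n : ℤ) : Idx d :=
  ⟨n.bmod d, by
    have hlower := Int.le_bmod (x := n) hd.pos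
    have hupper := Int.bmod_le (x := n) hd.pos
    obtain ⟨e, rfl⟩ := hd
    rw [Finset.mem_Icc]
    omega⟩

theorem wrap_coe (hd : Odd d) (p : Idx d) : wrap hd p = p := by
  have hp := Finset.mem_Icc.mp p.2
  obtain ⟨e, rfl⟩ := hd
  exact Subtype.ext (Int.bmod_eq_of_le (by omega) (by omega))

theorem wrap_eq_wrap_iff (hd : Odd d) (m n : ℤ) : wrap hd m = wrap hd n ↔ (d : ℤ) ∣ m - n := by
  rw [Subtype.ext_iff, wrap, wrap, Int.bmod_eq_bmod_iff_bmod_sub_eq_zero,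
    Int.dvd_iff_bmod_eq_zero]

theorem dvd_wrap_sub (hd : Odd d) (n : ℤ) : (d : ℤ) ∣ (wrap hd n : ℤ) - n :=
  Int.dvd_bmod_sub_self

theorem wrap_wrap_add (hd : Odd d) (m n : ℤ) : wrap hd (wrap hd m + n) = wrap hd (m + n) :=
  Subtype.ext Int.bmod_add_bmod

theorem card_idx (hd : Odd d) : Fintype.card (Idx d) = d := by
  rw [Fintype.card_coe, Int.card_Icc]
  obtain ⟨e, rfl⟩ := hd
  omega

/-- The cyclic shift of the labels by `m`. -/
def shiftEquiv (hd : Odd d) (m : ℤ) : Idx d ≃ Idx d where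
  toFun p := wrap hd (p + m)
  invFun p := wrap hd (p + -m)
  left_inv p := by simp [wrap_wrap_add, wrap_coe]
  right_inv p := by simp [wrap_wrap_add, wrap_coe]

theorem shiftEquiv_apply (hd : Odd d) (m : ℤ) (p : Idx d) :
    shiftEquiv hd m p = wrap hd (p + m) := rfl

theorem fourierChar_mul_wrap_div (hd : Odd d) (m n : ℤ) :
    𝐞 ((m : ℝ) * (wrap hd n : ℤ) / d) = 𝐞 ((m : ℝ) * n / d) := by
  have hdvd : (d : ℤ) ∣ m * (wrap hd n : ℤ) - m * n := by
    rw [← mul_sub]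
    exact (dvd_wrap_sub hd n).mul_left m
  exact_mod_cast fourierChar_div_congr hd.pos.ne' hdvd

theorem sum_fourierChar_mul_div (hd : Odd d) (r : ℤ) :
    ∑ k : Idx d, (𝐞 ((r : ℝ) * (k : ℤ) / d) : ℂ) = if (d : ℤ) ∣ r then (d : ℂ) else 0 := by
  split_ifs with hr
  · have hone (k : Idx d) : 𝐞 ((r : ℝ) * (k : ℤ) / d) = 1 := by
      exact_mod_cast (fourierChar_div_eq_one_iff hd.pos.ne' (r * k)).mpr (hr.mul_right _)
    simp only [hone, Circle.coe_one, Finset.sum_const, Finset.card_univ, card_idx hd,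
      nsmul_eq_mul, mul_one]
  · have hshift : (𝐞 ((r : ℝ) / d) : ℂ) * ∑ k : Idx d, (𝐞 ((r : ℝ) * (k : ℤ) / d) : ℂ) =
        ∑ k : Idx d, (𝐞 ((r : ℝ) * (k : ℤ) / d) : ℂ) := by
      conv_rhs => rw [← (shiftEquiv hd 1).sum_comp]
      rw [Finset.mul_sum]
      refine Finset.sum_congr rfl fun k _ => ?_
      rw [shiftEquiv_apply, fourierChar_mul_wrap_div, ← coe_fourierChar_add]
      congr 2
      push_cast
      ring
    have hne : (𝐞 ((r : ℝ) / d) : ℂ) ≠ 1 := fun h =>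
      hr ((fourierChar_div_eq_one_iff hd.pos.ne' r).mp (Circle.coe_eq_one.mp h))
    by_contra hsum
    exact hne (mul_eq_right₀ hsum |>.mp hshift)

theorem sum_fourierChar_mul_sub_div (hd : Odd d) (p q : Idx d) :
    ∑ k : Idx d, (𝐞 (((k : ℤ) : ℝ) * (((p : ℤ) : ℝ) - (q : ℤ)) / d) : ℂ) =
      if p = q then (d : ℂ) else 0 := by
  have hsum := sum_fourierChar_mul_div hd ((p : ℤ) - (q : ℤ))
  simp only [← wrap_eq_wrap_iff hd, wrap_coe] at hsum
  rw [← hsum]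
  refine Finset.sum_congr rfl fun k _ => ?_
  push_cast
  rw [mul_comm]

theorem hasSum_mul_wrap {R : Type*} [Ring R] [TopologicalSpace R] [IsTopologicalRing R]
    (hd : Odd d) {b B : ℤ → R} (hB : ∀ q : ℤ, HasSum (fun j : ℤ => b (q + d * j)) (B q))
    (G : Idx d → R) (p : ℤ) :
    HasSum (fun n : ℤ => b n * G (wrap hd (p + n))) (∑ p' : Idx d, B (p' - p) * G p') := by
  have hclass (p' : Idx d) : HasSum (fun n : ℤ => if wrap hd (p + n) = p' then b n * G p' else 0)
      (B (p' - p) * G p') := by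
    have hinj : Function.Injective fun j : ℤ => (p' : ℤ) - p + d * j := fun i j hij =>
      mul_left_cancel₀ (by exact_mod_cast hd.pos.ne') (add_left_cancel hij)
    have hwrap (n : ℤ) :
        wrap hd (p + n) = p' ↔ n ∈ Set.range fun j : ℤ => (p' : ℤ) - p + d * j := by
      rw [← wrap_coe hd p', wrap_eq_wrap_iff, wrap_coe]
      exact exists_congr fun j => by constructor <;> intro h <;> linarith
    rw [← hinj.hasSum_iff fun n hn => if_neg (hn ∘ (hwrap n).mp)]
    refine ((hB (p' - p)).mul_right (G p')).congr_fun fun j => ?_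
    exact if_pos ((hwrap _).mpr ⟨j, rfl⟩)
  refine (hasSum_sum fun p' _ => hclass p').congr_fun fun n => ?_
  simp

end Labels

section JumpMatrix

variable {d : ℕ} {σsq : ℝ}

/-- The centred Gaussian law on the integers with parameter `2 σ² / d`: its reduction modulo `d` is
the jump distribution `jumpProb`. -/
def jumpWeight (d : ℕ) (σsq : ℝ) (n : ℤ) : ℝ :=
  gaussWeight (2 * σsq / d) n / theta3 0 (2 * σsq / d)

theorem hasSum_jumpWeight (hd : 0 < d) (hσ : 0 < σsq) : HasSum (jumpWeight d σsq) 1 := by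
  have hs : 0 < 2 * σsq / d := by positivity
  rw [← div_self (theta3_pos hs 0).ne']
  exact (hasSum_theta3_zero hs).div_const _

theorem hasSum_jumpWeight_residue (hd : 0 < d) (hσ : 0 < σsq) (q : ℤ) :
    HasSum (fun j : ℤ => jumpWeight d σsq (q + d * j)) (jumpProb d σsq q) := by
  have hs : 0 < 1 / (2 * σsq * d) := by positivity
  have hprob : √(1 / (2 * σsq * d)) * theta3 (q / d) (1 / (2 * σsq * d)) /
      theta3 0 (2 * σsq / d) = jumpProb d σsq q := by
    rw [jumpProb, sqrt_div zero_le_one, sqrt_one, one_div_mul_eq_div, div_div]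
  rw [← hprob]
  refine ((hasSum_sqrt_mul_theta3 hs (q / d)).div_const _).congr_fun fun j => ?_
  simp only [jumpWeight, gaussWeight]
  congr 3
  push_cast
  field_simp

theorem jumpProb_nonneg (hd : 0 < d) (hσ : 0 < σsq) (q : ℤ) : 0 ≤ jumpProb d σsq q :=
  (div_pos (theta3_pos (by positivity) _)
    (mul_pos (by positivity) (theta3_pos (by positivity) _))).le

theorem le_sqrt_mul_theta3_zero (hd : 0 < d) (hσ : 0 < σsq) :
    (d : ℝ) ≤ √(2 * σsq * d) * theta3 0 (2 * σsq / d) := by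
  have hs : 0 < 2 * σsq / d := by positivity
  have hsqrt : √(2 * σsq * d) = d * √(2 * σsq / d) := by
    rw [show 2 * σsq * d = (d : ℝ) ^ 2 * (2 * σsq / d) by field_simp, sqrt_mul (sq_nonneg _),
      sqrt_sq d.cast_nonneg]
  rw [hsqrt, mul_assoc, sqrt_mul_theta3_zero hs]
  exact le_mul_of_one_le_right d.cast_nonneg (one_le_theta3_zero (one_div_pos.mpr hs))

theorem jumpProb_le (hd : 0 < d) (hσ : 0 < σsq) (q : ℤ) :
    jumpProb d σsq q ≤ theta3 0 1 * (1 + √(2 * σsq * d)) / d := by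
  have hs : 0 < 2 * σsq * d := by positivity
  have hnum : theta3 (q / d) (1 / (2 * σsq * d)) ≤ theta3 0 1 * (1 + √(2 * σsq * d)) :=
    (theta3_le_theta3_zero (one_div_pos.mpr hs) _).trans (theta3_zero_one_div_le hs)
  exact div_le_div₀ ((theta3_pos (one_div_pos.mpr hs) _).le.trans hnum) hnum
    (Nat.cast_pos.mpr hd) (le_sqrt_mul_theta3_zero hd hσ)

/-- The transition matrix of the random walk on the labels. -/
def jumpMatrix (d : ℕ) (σsq : ℝ) : Matrix (Idx d) (Idx d) ℝ :=
  Matrix.of fun p p' => jumpProb d σsq (p' - p)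

theorem jumpMatrix_apply (p p' : Idx d) : jumpMatrix d σsq p p' = jumpProb d σsq (p' - p) := rfl

theorem hasSum_jumpWeight_mul_wrap (hd : Odd d) (hσ : 0 < σsq) (f : Idx d → ℂ) (p : ℤ) :
    HasSum (fun n : ℤ => (jumpWeight d σsq n : ℂ) * f (wrap hd (p + n)))
      (∑ p' : Idx d, (jumpProb d σsq (p' - p) : ℂ) * f p') :=
  hasSum_mul_wrap hd (b := fun n => (jumpWeight d σsq n : ℂ)) (B := fun q => jumpProb d σsq q)
    (fun q => Complex.hasSum_ofReal.mpr (hasSum_jumpWeight_residue hd.pos hσ q)) f p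

theorem jumpMatrix_mem_rowStochastic (hd : Odd d) (hσ : 0 < σsq) :
    jumpMatrix d σsq ∈ Matrix.rowStochastic ℝ (Idx d) := by
  refine Matrix.mem_rowStochastic_iff_sum.mpr
    ⟨fun p p' => jumpProb_nonneg hd.pos hσ _, fun p => ?_⟩
  have hsum := hasSum_jumpWeight_mul_wrap hd hσ (fun _ => 1) p
  simp only [mul_one] at hsum
  exact_mod_cast hsum.unique (Complex.hasSum_ofReal.mpr (hasSum_jumpWeight hd.pos hσ))

/-- The eigenvalue of the transition matrix for the character `p ↦ e^{2πimp/d}`. -/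
def jumpEigenvalue (d : ℕ) (σsq : ℝ) (m : ℤ) : ℝ :=
  theta3 (m / d) (2 * σsq / d) / theta3 0 (2 * σsq / d)

theorem jumpEigenvalue_nonneg (hd : 0 < d) (hσ : 0 < σsq) (m : ℤ) : 0 ≤ jumpEigenvalue d σsq m :=
  (div_pos (theta3_pos (by positivity) _) (theta3_pos (by positivity) _)).le

theorem jumpEigenvalue_zero (hd : 0 < d) (hσ : 0 < σsq) : jumpEigenvalue d σsq 0 = 1 := by
  have hs : 0 < 2 * σsq / d := by positivity
  rw [jumpEigenvalue, Int.cast_zero, zero_div, div_self (theta3_pos hs 0).ne']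

theorem sum_jumpMatrix_mul_fourierChar (hd : Odd d) (hσ : 0 < σsq) (m : ℤ) (p : Idx d) :
    ∑ p' : Idx d, (jumpMatrix d σsq p p' : ℂ) * 𝐞 ((m : ℝ) * (p' : ℤ) / d) =
      jumpEigenvalue d σsq m * 𝐞 ((m : ℝ) * (p : ℤ) / d) := by
  have hd0 := hd.pos
  have hs : 0 < 2 * σsq / d := by positivity
  have htheta := ((hasSum_theta3 hs (m / d)).div_const (theta3 0 (2 * σsq / d) : ℂ)).mul_right
    (𝐞 ((m : ℝ) * (p : ℤ) / d) : ℂ)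
  rw [jumpEigenvalue, Complex.ofReal_div]
  refine (hasSum_jumpWeight_mul_wrap hd hσ (fun p' => 𝐞 ((m : ℝ) * (p' : ℤ) / d)) p).unique
    (htheta.congr_fun fun n => ?_)
  rw [fourierChar_mul_wrap_div, show (m : ℝ) * ((p + n : ℤ) : ℝ) / d =
    n * (m / d) + m * (p : ℤ) / d by push_cast; ring, coe_fourierChar_add, jumpWeight]
  push_cast
  ring

theorem jumpMatrix_pow_apply (hd : Odd d) (hσ : 0 < σsq) (k : ℕ) (p a : Idx d) :
    ((jumpMatrix d σsq ^ k) p a : ℂ) = (∑ m : Idx d, (jumpEigenvalue d σsq m : ℂ) ^ k *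
      𝐞 (((m : ℤ) : ℝ) * (((p : ℤ) : ℝ) - (a : ℤ)) / d)) / d := by
  have hd0 : (d : ℂ) ≠ 0 := by exact_mod_cast hd.pos.ne'
  induction k generalizing p with
  | zero =>
    simp only [pow_zero, one_mul, sum_fourierChar_mul_sub_div hd, Matrix.one_apply]
    split_ifs <;> simp [hd0]
  | succ k ih =>
    have hsplit (q m : Idx d) : (𝐞 (((m : ℤ) : ℝ) * (((q : ℤ) : ℝ) - (a : ℤ)) / d) : ℂ) =
        𝐞 (((m : ℤ) : ℝ) * (q : ℤ) / d) * 𝐞 (-(((m : ℤ) : ℝ) * (a : ℤ) / d)) := by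
      rw [← coe_fourierChar_add]
      congr 2
      ring
    rw [pow_succ', Matrix.mul_apply, Complex.ofReal_sum]
    simp only [Complex.ofReal_mul, ih, hsplit, Finset.sum_div, Finset.mul_sum]
    rw [Finset.sum_comm]
    refine Finset.sum_congr rfl fun m _ => ?_
    calc ∑ q, (jumpMatrix d σsq p q : ℂ) * ((jumpEigenvalue d σsq m : ℂ) ^ k *
          (𝐞 (((m : ℤ) : ℝ) * (q : ℤ) / d) * 𝐞 (-(((m : ℤ) : ℝ) * (a : ℤ) / d))) / d)
        = (∑ q, (jumpMatrix d σsq p q : ℂ) * 𝐞 (((m : ℤ) : ℝ) * (q : ℤ) / d)) *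
          ((jumpEigenvalue d σsq m : ℂ) ^ k * 𝐞 (-(((m : ℤ) : ℝ) * (a : ℤ) / d)) / d) := by
          rw [Finset.sum_mul]
          exact Finset.sum_congr rfl fun q _ => by ring
      _ = _ := by rw [sum_jumpMatrix_mul_fourierChar hd hσ]; ring

theorem abs_jumpMatrix_pow_sub_le (hd : Odd d) {r : ℝ} (hσ : 0 < σsq) (hr₀ : 0 ≤ r)
    (hr : ∀ m : Idx d, (m : ℤ) ≠ 0 → jumpEigenvalue d σsq m ≤ r) (k : ℕ) (p a : Idx d) :
    |(jumpMatrix d σsq ^ k) p a - 1 / d| ≤ r ^ k := by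
  have hd0 : (0 : ℝ) < d := Nat.cast_pos.mpr hd.pos
  have hzero_coe : ((wrap hd 0 : Idx d) : ℤ) = 0 := Int.zero_bmod
  have hterm : ∀ m ∈ Finset.univ.erase (wrap hd 0), ‖(jumpEigenvalue d σsq m : ℂ) ^ k *
      𝐞 (((m : ℤ) : ℝ) * (((p : ℤ) : ℝ) - (a : ℤ)) / d)‖ ≤ r ^ k := fun m hm => by
    have hm0 : (m : ℤ) ≠ 0 := fun h =>
      (Finset.mem_erase.mp hm).1 (Subtype.ext (h.trans hzero_coe.symm))
    rw [norm_mul, Circle.norm_coe, mul_one, norm_pow, Complex.norm_real, norm_eq_abs,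
      abs_of_nonneg (jumpEigenvalue_nonneg hd.pos hσ _)]
    exact pow_le_pow_left₀ (jumpEigenvalue_nonneg hd.pos hσ _) (hr m hm0) k
  have hspectral := jumpMatrix_pow_apply hd hσ k p a
  rw [← Finset.add_sum_erase _ _ (Finset.mem_univ (wrap hd 0)), hzero_coe,
    jumpEigenvalue_zero hd.pos hσ, Int.cast_zero, zero_mul, zero_div, AddChar.map_zero_eq_one,
    Circle.coe_one, Complex.ofReal_one, one_pow, one_mul, add_div,
    ← sub_eq_iff_eq_add'] at hspectral
  rw [← norm_eq_abs, ← Complex.norm_real, Complex.ofReal_sub, Complex.ofReal_div,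
    Complex.ofReal_one, Complex.ofReal_natCast, hspectral, norm_div, Complex.norm_natCast,
    div_le_iff₀' hd0]
  refine (norm_sum_le_of_le _ hterm).trans ?_
  rw [Finset.sum_const, nsmul_eq_mul]
  gcongr
  exact (Finset.card_le_univ _).trans_eq (card_idx hd)

end JumpMatrix

section MarkovChain

variable {X : Type*} [DecidableEq X]

/-- The factor `1 - c 1_{p = a}` collected at the state `p`. -/
def hitFactor (a : X) (c : ℝ) (p : X) : ℝ := 1 - c * if p = a then 1 else 0

theorem abs_hitFactor_le_one (a : X) {c : ℝ} (hc : c ∈ Set.Icc (0 : ℝ) 2) (p : X) :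
    |hitFactor a c p| ≤ 1 := by
  rw [hitFactor, abs_le]
  split_ifs <;> constructor <;> linarith [hc.1, hc.2]

variable [Fintype X] {P : Matrix X X ℝ}

theorem sum_mul_le_of_mem_rowStochastic (hP : P ∈ Matrix.rowStochastic ℝ X) {f : X → ℝ} {M : ℝ}
    (hf : ∀ q, f q ≤ M) (p : X) : ∑ q, P p q * f q ≤ M :=
  calc ∑ q, P p q * f q ≤ ∑ q, P p q * M :=
        Finset.sum_le_sum fun q _ =>
          mul_le_mul_of_nonneg_left (hf q) (Matrix.nonneg_of_mem_rowStochastic hP)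
    _ = M := by rw [← Finset.sum_mul, Matrix.sum_row_of_mem_rowStochastic hP, one_mul]

theorem pow_succ_apply_le (hP : P ∈ Matrix.rowStochastic ℝ X) {a : X} {M : ℝ}
    (hM : ∀ q, P q a ≤ M) (k : ℕ) (p : X) : (P ^ (k + 1)) p a ≤ M := by
  rw [pow_succ, Matrix.mul_apply]
  exact sum_mul_le_of_mem_rowStochastic (pow_mem hP k) hM p

/-- The expected number of visits of `a` during the times `1, …, n` of the chain with transition
matrix `P` started at `p`. -/
def expectedVisits (P : Matrix X X ℝ) (a : X) (n : ℕ) (p : X) : ℝ :=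
  ∑ k ∈ Finset.range n, (P ^ (k + 1)) p a

theorem expectedVisits_mono (hP : P ∈ Matrix.rowStochastic ℝ X) (a : X) (p : X) :
    Monotone fun n => expectedVisits P a n p := fun _ _ h =>
  Finset.sum_le_sum_of_subset_of_nonneg (Finset.range_mono h) fun k _ _ =>
    Matrix.nonneg_of_mem_rowStochastic (pow_mem hP (k + 1))

theorem expectedVisits_le (hP : P ∈ Matrix.rowStochastic ℝ X) {a : X} {M : ℝ}
    (hM : ∀ q, P q a ≤ M) (n : ℕ) (p : X) : expectedVisits P a n p ≤ n * M := by
  rw [← nsmul_eq_mul]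
  exact (Finset.sum_le_card_nsmul _ _ M fun k _ => pow_succ_apply_le hP hM k p).trans_eq
    (by rw [Finset.card_range])

/-- The expectation of `∏_{1 ≤ k ≤ n} (1 - c 1_{X_k = a})` for the chain `X_0, X_1, …` with
transition matrix `P` started at `p`; the starting point contributes no factor. -/
def hitExpectation (P : Matrix X X ℝ) (a : X) (c : ℝ) : ℕ → X → ℝ
  | 0 => 1
  | n + 1 => P *ᵥ (hitFactor a c * hitExpectation P a c n)

theorem hitExpectation_succ_apply (a : X) (c : ℝ) (n : ℕ) (p : X) :
    hitExpectation P a c (n + 1) p =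
      ∑ q, P p q * (hitFactor a c q * hitExpectation P a c n q) := rfl

theorem abs_hitExpectation_le_one (hP : P ∈ Matrix.rowStochastic ℝ X) (a : X) {c : ℝ}
    (hc : c ∈ Set.Icc (0 : ℝ) 2) (n : ℕ) (p : X) : |hitExpectation P a c n p| ≤ 1 := by
  induction n generalizing p with
  | zero => simp [hitExpectation]
  | succ n ih =>
    rw [hitExpectation_succ_apply]
    refine (Finset.abs_sum_le_sum_abs _ _).trans ?_
    simp only [abs_mul, abs_of_nonneg (Matrix.nonneg_of_mem_rowStochastic hP)]
    exact sum_mul_le_of_mem_rowStochastic hP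
      (fun q => mul_le_one₀ (abs_hitFactor_le_one a hc q) (abs_nonneg _) (ih q)) p

theorem one_sub_hitExpectation (hP : P ∈ Matrix.rowStochastic ℝ X) (a : X) (c : ℝ) (n : ℕ)
    (p : X) :
    1 - hitExpectation P a c n p =
      c * ∑ k ∈ Finset.range n, (P ^ (k + 1)) p a * hitExpectation P a c (n - 1 - k) a := by
  induction n generalizing p with
  | zero => simp [hitExpectation]
  | succ n ih =>
    have hstep : 1 - hitExpectation P a c (n + 1) p =
        ∑ q, P p q * (1 - hitExpectation P a c n q) + c * (P p a * hitExpectation P a c n a) := by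
      simp only [hitExpectation_succ_apply, hitFactor, mul_ite, mul_one, mul_zero, sub_mul, one_mul,
        ite_mul, zero_mul, mul_sub, mul_left_comm, Finset.sum_sub_distrib, Finset.sum_ite_eq',
        Finset.mem_univ, ↓reduceIte, Matrix.sum_row_of_mem_rowStochastic hP]
      ring
    have hlater : ∑ q, P p q * (1 - hitExpectation P a c n q) =
        c * ∑ k ∈ Finset.range n,
          (P ^ (k + 1 + 1)) p a * hitExpectation P a c (n - (k + 1)) a := by
      simp only [ih, pow_succ' P (_ + 1), Matrix.mul_apply, Finset.mul_sum, Finset.sum_mul]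
      rw [Finset.sum_comm]
      refine Finset.sum_congr rfl fun k _ => Finset.sum_congr rfl fun q _ => ?_
      rw [Nat.sub_sub, add_comm 1 k]
      ring
    rw [hstep, hlater, Finset.sum_range_succ', zero_add, pow_one, add_tsub_cancel_right,
      Nat.sub_zero, mul_add]

theorem one_sub_mul_expectedVisits_le (hP : P ∈ Matrix.rowStochastic ℝ X) (a : X) {c : ℝ}
    (hc : c ∈ Set.Icc (0 : ℝ) 2) (n : ℕ) (p : X) :
    1 - c * expectedVisits P a n p ≤ hitExpectation P a c n p := by
  rw [sub_le_comm, one_sub_hitExpectation hP]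
  refine mul_le_mul_of_nonneg_left (Finset.sum_le_sum fun k _ => ?_) hc.1
  exact mul_le_of_le_one_right (Matrix.nonneg_of_mem_rowStochastic (pow_mem hP _))
    (abs_le.mp (abs_hitExpectation_le_one hP a hc _ a)).2

theorem hitExpectation_le (hP : P ∈ Matrix.rowStochastic ℝ X) {a : X} {c ρ : ℝ}
    (hc : c ∈ Set.Icc (0 : ℝ) 2) {n : ℕ} (hρ : expectedVisits P a n a ≤ ρ) (p : X) :
    hitExpectation P a c n p ≤ 1 - c * (1 - c * ρ) * expectedVisits P a n p := by
  rw [le_sub_comm, one_sub_hitExpectation hP, mul_assoc, expectedVisits, Finset.mul_sum]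
  refine mul_le_mul_of_nonneg_left (Finset.sum_le_sum fun k _ => ?_) hc.1
  rw [mul_comm]
  refine mul_le_mul_of_nonneg_left ?_ (Matrix.nonneg_of_mem_rowStochastic (pow_mem hP _))
  have hvisits : expectedVisits P a (n - 1 - k) a ≤ ρ :=
    (expectedVisits_mono hP a a (by omega)).trans hρ
  exact (sub_le_sub_left (mul_le_mul_of_nonneg_left hvisits hc.1) 1).trans
    (one_sub_mul_expectedVisits_le hP a hc _ a)

end MarkovChain

section SpectralGap

theorem sqrt_mul_theta3_le {s z : ℝ} (hs : 0 < s) (hs4 : 4 * s ≤ 1) (hz : |z| ≤ 1 / 2) :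
    √s * theta3 z s ≤ rexp (-(π * z ^ 2 / s)) + rexp (π - π / (4 * s)) * theta3 0 1 := by
  have hterm (j : ℤ) : rexp (-(π * (z + j) ^ 2 / s)) ≤
      (if j = 0 then rexp (-(π * z ^ 2 / s)) else 0) +
        rexp (π - π / (4 * s)) * gaussWeight 1 j := by
    split_ifs with hj
    · rw [hj, Int.cast_zero, add_zero]
      exact le_add_of_nonneg_right (mul_pos (exp_pos _) (gaussWeight_pos 1 0)).le
    · rw [zero_add, gaussWeight, ← exp_add, exp_le_exp]
      have hj_abs : (1 : ℝ) ≤ |(j : ℝ)| := by exact_mod_cast Int.one_le_abs hj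
      have hj_sq : 1 ≤ (j : ℝ) ^ 2 := (one_le_sq_iff_one_le_abs _).mpr hj_abs
      have hdist : (j : ℝ) ^ 2 / 4 ≤ (z + j) ^ 2 := by
        have htri := abs_sub_abs_le_abs_sub (j : ℝ) (-z)
        rw [abs_neg, sub_neg_eq_add, add_comm (j : ℝ) z] at htri
        rw [← sq_abs (z + j), ← sq_abs (j : ℝ)]
        nlinarith [abs_nonneg (z + j)]
      have hsplit : 1 + 4 * s * ((j : ℝ) ^ 2 - 1) ≤ (j : ℝ) ^ 2 := by nlinarith
      calc -(π * (z + j) ^ 2 / s) ≤ -(π * ((1 + 4 * s * ((j : ℝ) ^ 2 - 1)) / 4) / s) := by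
            gcongr
            linarith
        _ = π - π / (4 * s) + -(π * 1 * (j : ℝ) ^ 2) := by
            field_simp
            ring
  exact hasSum_le hterm (hasSum_sqrt_mul_theta3 hs z)
    ((hasSum_ite_eq 0 _).add ((hasSum_theta3_zero one_pos).mul_left _))

theorem theta3_div_theta3_zero_le {s : ℝ} (hs : 0 < s) (z : ℝ) :
    theta3 z s / theta3 0 s ≤ √s * theta3 z s := by
  rw [div_le_iff₀ (theta3_pos hs 0), mul_right_comm, sqrt_mul_theta3_zero hs]
  exact le_mul_of_one_le_left (theta3_pos hs z).le (one_le_theta3_zero (one_div_pos.mpr hs))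

theorem exp_neg_add_mul_exp_le {x N A : ℝ} (hx : 0 < x) (hN : 8 ≤ N) (hA : 0 ≤ A)
    (hAN : 16 * A ≤ N * x ^ 2) :
    rexp (-x) + A * rexp (-(N * x / 4)) ≤ rexp (-(x / 2)) := by
  have hexp : rexp (-(N * x / 4)) ≤ rexp (-x) * rexp (-(N * x / 8)) := by
    rw [← exp_add, exp_le_exp]
    nlinarith
  have hinv : rexp (-(N * x / 8)) ≤ 8 / (N * x) := by
    rw [exp_neg, ← inv_div (N * x) 8]
    exact inv_anti₀ (by positivity) (by linarith [add_one_le_exp (N * x / 8)])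
  have hA_le : A * (8 / (N * x)) ≤ x / 2 := by
    rw [mul_div_assoc', div_le_iff₀ (by positivity)]
    linarith
  calc rexp (-x) + A * rexp (-(N * x / 4))
      ≤ rexp (-x) + A * (rexp (-x) * (8 / (N * x))) := by
        gcongr
        exact hexp.trans (by gcongr)
    _ = rexp (-x) * (A * (8 / (N * x)) + 1) := by ring
    _ ≤ rexp (-x) * rexp (x / 2) := by
        gcongr
        exact (add_le_add_left hA_le 1).trans (add_one_le_exp _)
    _ = rexp (-(x / 2)) := by
        rw [← exp_add]
        ring_nf

theorem abs_coe_le {d : ℕ} (m : Idx d) : |((m : ℤ) : ℝ)| ≤ d / 2 := by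
  have hm := Finset.mem_Icc.mp m.2
  have hlower : -(d : ℤ) ≤ 2 * m := by omega
  have hupper : 2 * (m : ℤ) ≤ d := by omega
  rify at hlower hupper
  exact abs_le.mpr ⟨by linarith, by linarith⟩

theorem jumpEigenvalue_le {d : ℕ} {σsq : ℝ} (hd : 3 ≤ d) (hσ : 0 < σsq) (hσd : 8 * σsq ≤ d)
    (hsmall : 16 * (theta3 0 1 * rexp π) ≤ (π / (2 * σsq)) ^ 2) {m : Idx d} (hm : (m : ℤ) ≠ 0) :
    jumpEigenvalue d σsq m ≤ rexp (-(π / (4 * σsq * d))) := by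
  have hd3 : (3 : ℝ) ≤ d := by exact_mod_cast hd
  have hd0 : (0 : ℝ) < d := by linarith
  have hm_sq : 1 ≤ ((m : ℤ) : ℝ) ^ 2 := by
    exact_mod_cast (one_le_sq_iff_one_le_abs (m : ℤ)).mpr (Int.one_le_abs hm)
  have hz : |((m : ℤ) : ℝ) / d| ≤ 1 / 2 := by
    rw [abs_div, abs_of_pos hd0, div_le_iff₀ hd0]
    linarith [abs_coe_le m]
  have hs : 0 < 2 * σsq / d := by positivity
  have hs4 : 4 * (2 * σsq / d) ≤ 1 := by
    rw [mul_div_assoc', div_le_one₀ hd0]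
    linarith
  calc jumpEigenvalue d σsq m
      ≤ rexp (-(π * (((m : ℤ) : ℝ) / d) ^ 2 / (2 * σsq / d))) +
          rexp (π - π / (4 * (2 * σsq / d))) * theta3 0 1 :=
        (theta3_div_theta3_zero_le hs _).trans (sqrt_mul_theta3_le hs hs4 hz)
    _ = rexp (-(π / (2 * σsq * d) * ((m : ℤ) : ℝ) ^ 2)) +
          theta3 0 1 * rexp π * rexp (-((d : ℝ) ^ 2 * (π / (2 * σsq * d)) / 4)) := by
        have hlead : π * (((m : ℤ) : ℝ) / d) ^ 2 / (2 * σsq / d) =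
            π / (2 * σsq * d) * ((m : ℤ) : ℝ) ^ 2 := by field_simp
        have htail : π / (4 * (2 * σsq / d)) = (d : ℝ) ^ 2 * (π / (2 * σsq * d)) / 4 := by
          field_simp
        rw [hlead, htail, sub_eq_add_neg π, exp_add]
        ring
    _ ≤ rexp (-(π / (2 * σsq * d))) +
          theta3 0 1 * rexp π * rexp (-((d : ℝ) ^ 2 * (π / (2 * σsq * d)) / 4)) := by
        gcongr
        exact le_mul_of_one_le_right (by positivity) hm_sq
    _ ≤ rexp (-(π / (2 * σsq * d) / 2)) := by
        refine exp_neg_add_mul_exp_le (by positivity) (by nlinarith)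
          (mul_pos (theta3_pos one_pos 0) (exp_pos π)).le (hsmall.trans_eq ?_)
        field_simp
    _ = rexp (-(π / (4 * σsq * d))) := by
        congr 2
        field_simp
        norm_num

theorem le_expectedVisits_jumpMatrix {d : ℕ} {σsq r : ℝ} (hd : Odd d) (hσ : 0 < σsq) (hr₀ : 0 ≤ r)
    (hr₁ : r ≤ 1) (hr : ∀ m : Idx d, (m : ℤ) ≠ 0 → jumpEigenvalue d σsq m ≤ r) (a : Idx d)
    {s n : ℕ} (hsn : s ≤ n) (p : Idx d) :
    ((n : ℝ) - s) * (1 / d - r ^ s) ≤ expectedVisits (jumpMatrix d σsq) a n p := by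
  have hP := jumpMatrix_mem_rowStochastic hd hσ
  have hterm : ∀ k ∈ Finset.Ico s n, 1 / d - r ^ s ≤ (jumpMatrix d σsq ^ (k + 1)) p a :=
    fun k hk => by
      have hpow : r ^ (k + 1) ≤ r ^ s :=
        pow_le_pow_of_le_one hr₀ hr₁ ((Finset.mem_Ico.mp hk).1.trans k.le_succ)
      have hdist := (abs_le.mp (abs_jumpMatrix_pow_sub_le hd hσ hr₀ hr (k + 1) p a)).1
      linarith
  have hsum := Finset.card_nsmul_le_sum _ _ _ hterm
  rw [Nat.card_Ico, nsmul_eq_mul, Nat.cast_sub hsn] at hsum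
  refine hsum.trans (Finset.sum_le_sum_of_subset_of_nonneg (fun k hk => ?_) fun k _ _ => ?_)
  · exact Finset.mem_range.mpr (Finset.mem_Ico.mp hk).2
  · exact Matrix.nonneg_of_mem_rowStochastic (pow_mem hP (k + 1))

end SpectralGap

section RandomWalk

variable {d : ℕ}

/-- The label `(d-1)/2`, the only one that the cyclic shift by one wraps around. -/
def lastLabel (hd : Odd d) : Idx d :=
  ⟨((d : ℤ) - 1) / 2, by
    obtain ⟨e, rfl⟩ := hd
    rw [Finset.mem_Icc]
    omega⟩

theorem antipodeProduct_eq_prod_hitFactor (hd : Odd d) (c : ℝ) (n : ℕ) (p : Fin (n + 1) → Idx d) :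
    antipodeProduct d c n p = ∏ j, hitFactor (lastLabel hd) c (p j) := by
  simp only [antipodeProduct, hitFactor, Subtype.ext_iff, lastLabel]

theorem walkExpectation_prod_succ (σsq : ℝ) (f : Idx d → ℝ) (n : ℕ) (p₁ : Idx d) :
    walkExpectation d σsq (n + 1) p₁ (fun p => ∏ j, f (p j)) =
      f p₁ * ∑ q, jumpMatrix d σsq p₁ q * walkExpectation d σsq n q (fun p => ∏ j, f (p j)) := by
  have hjumps (x : Idx d) (p : Fin (n + 1) → Idx d) :
      ∏ j : Fin (n + 1), jumpProb d σsq
        (((Fin.cons x p : Fin (n + 2) → Idx d) j.succ : ℤ)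
          - ((Fin.cons x p : Fin (n + 2) → Idx d) j.castSucc : ℤ)) =
      jumpMatrix d σsq x (p 0) * ∏ j : Fin n, jumpProb d σsq ((p j.succ : ℤ) - p j.castSucc) := by
    simp [Fin.prod_univ_succ, jumpMatrix_apply]
  rw [walkExpectation, ← (Fin.consEquiv fun _ => Idx d).sum_comp, Fintype.sum_prod_type_right]
  simp only [Fin.consEquiv, Equiv.coe_fn_mk, hjumps]
  simp only [Fin.prod_univ_succ (fun _ : Fin (n + 2) => _), Fin.cons_zero, Fin.cons_succ,
    Finset.sum_ite_eq', Finset.mem_univ, if_true, walkExpectation, Finset.mul_sum]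
  rw [Finset.sum_comm]
  refine Finset.sum_congr rfl fun p _ => ?_
  simp only [mul_ite, mul_zero, Finset.sum_ite_eq, Finset.mem_univ, if_true]
  ring

theorem walkExpectation_antipodeProduct (hd : Odd d) (σsq c : ℝ) (n : ℕ) (p : Idx d) :
    walkExpectation d σsq n p (antipodeProduct d c n) =
      hitFactor (lastLabel hd) c p *
        hitExpectation (jumpMatrix d σsq) (lastLabel hd) c n p := by
  simp only [funext (antipodeProduct_eq_prod_hitFactor hd c n)]
  induction n generalizing p with
  | zero =>
    rw [walkExpectation, ← (Equiv.funUnique (Fin 1) (Idx d)).symm.sum_comp]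
    simp [hitExpectation]
  | succ n ih => simp only [walkExpectation_prod_succ, ih, hitExpectation_succ_apply]

end RandomWalk

section Asymptotics

theorem tendsto_natCast_rpow_atTop {γ : ℝ} (hγ : 0 < γ) :
    Tendsto (fun d : ℕ => (d : ℝ) ^ γ) atTop atTop :=
  (tendsto_rpow_atTop hγ).comp tendsto_natCast_atTop_atTop

theorem tendsto_natCast_rpow_nhds_zero {γ : ℝ} (hγ : γ < 0) :
    Tendsto (fun d : ℕ => (d : ℝ) ^ γ) atTop (𝓝 0) := by
  simpa only [neg_neg, Function.comp_def] using
    (tendsto_rpow_neg_atTop (neg_pos.mpr hγ)).comp (tendsto_natCast_atTop_atTop (R := ℝ))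

theorem tendsto_natCast_mul_exp_neg_rpow {κ γ : ℝ} (hκ : 0 < κ) (hγ : 0 < γ) :
    Tendsto (fun d : ℕ => (d : ℝ) * rexp (-(κ * (d : ℝ) ^ γ))) atTop (𝓝 0) := by
  refine ((tendsto_rpow_mul_exp_neg_mul_atTop_nhds_zero (1 / γ) κ hκ).comp
    (tendsto_natCast_rpow_atTop hγ)).congr fun d => ?_
  simp only [Function.comp]
  rw [← rpow_mul d.cast_nonneg, mul_one_div_cancel hγ.ne', rpow_one, neg_mul]

variable {c₂ t β : ℝ}

theorem eventually_jumpEigenvalue_le (hc₂ : 0 < c₂) (hβ : β < 0) :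
    ∀ᶠ d : ℕ in atTop, ∀ m : Idx d, (m : ℤ) ≠ 0 →
      jumpEigenvalue d (c₂ * (d : ℝ) ^ β) m ≤ rexp (-(π / (4 * (c₂ * (d : ℝ) ^ β) * d))) := by
  have hσ_lim : Tendsto (fun d : ℕ => c₂ * (d : ℝ) ^ β) atTop (𝓝 0) := by
    simpa using (tendsto_natCast_rpow_nhds_zero hβ).const_mul c₂
  have hσsq_lim : Tendsto (fun d : ℕ =>
      16 * (theta3 0 1 * rexp π) * (2 * (c₂ * (d : ℝ) ^ β)) ^ 2) atTop (𝓝 0) := by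
    simpa using ((hσ_lim.const_mul 2).pow 2).const_mul (16 * (theta3 0 1 * rexp π))
  filter_upwards [hσ_lim.eventually_lt_const (u := 3 / 8) (by norm_num),
    hσsq_lim.eventually_lt_const (u := π ^ 2) (by positivity), eventually_ge_atTop 3]
    with d hσ_lt hσsq_lt hd m hm
  have hd3 : (3 : ℝ) ≤ d := by exact_mod_cast hd
  have hσ : 0 < c₂ * (d : ℝ) ^ β := by positivity
  refine jumpEigenvalue_le hd hσ (by linarith) ?_ hm
  rw [div_pow, le_div_iff₀ (by positivity)]
  exact hσsq_lt.le

theorem le_expectedVisits_of_mixing {d : ℕ} {σsq r η : ℝ} (hd : Odd d) (hσ : 0 < σsq)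
    (hr₀ : 0 ≤ r) (hr₁ : r ≤ 1) (hr : ∀ m : Idx d, (m : ℤ) ≠ 0 → jumpEigenvalue d σsq m ≤ r)
    (ht : 0 < t) (hη₀ : 0 < η) (hη₁ : η < 1 / 3) (hlarge : 2 ≤ η * t * √d)
    (hmix : d * r ^ ⌈η * t * √d⌉₊ ≤ η) {n : ℕ} (hn : n + 1 = ⌈t * √d⌉₊) (a p : Idx d) :
    (1 - 3 * η) * (t / √d) ≤ expectedVisits (jumpMatrix d σsq) a n p := by
  have hd0 : (0 : ℝ) < d := Nat.cast_pos.mpr hd.pos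
  have hsqrt : √(d : ℝ) ^ 2 = d := sq_sqrt hd0.le
  have : 0 < √(d : ℝ) := sqrt_pos.mpr hd0
  set s : ℕ := ⌈η * t * √d⌉₊
  have hs : (s : ℝ) < η * t * √d + 1 := Nat.ceil_lt_add_one (by positivity)
  have hn_ge : t * √d ≤ n + 1 := by exact_mod_cast hn ▸ Nat.le_ceil (t * √d)
  have htime : (1 - 2 * η) * (t * √d) ≤ n - s := by linarith
  have htime_nonneg : 0 ≤ (1 - 2 * η) * (t * √d) := mul_nonneg (by linarith) (by positivity)
  have hsn : s ≤ n := by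
    rify
    linarith
  calc (1 - 3 * η) * (t / √d) ≤ (1 - 2 * η) * (1 - η) * (t / √d) := by
        gcongr
        nlinarith
    _ = (1 - 2 * η) * (t * √d) * ((1 - η) / d) := by
        nth_rw 3 [← hsqrt]
        field_simp
    _ ≤ (n - s) * ((1 - d * r ^ s) / d) := by
        have hmix' : 1 - η ≤ 1 - d * r ^ s := by linarith
        have hη : 0 ≤ (1 - η) / d := div_nonneg (by linarith) hd0.le
        exact mul_le_mul htime (div_le_div_of_nonneg_right hmix' hd0.le) hη
          (htime_nonneg.trans htime)
    _ = (n - s) * (1 / d - r ^ s) := by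
        field_simp
    _ ≤ _ := le_expectedVisits_jumpMatrix hd hσ hr₀ hr₁ hr a hsn p

theorem eventually_le_expectedVisits {ε : ℝ} (hc₂ : 0 < c₂) (ht : 0 < t) (hβ : β < -(1 / 2))
    (hε₀ : 0 < ε) (hε₁ : ε < 1) :
    ∀ᶠ d : ℕ in atTop, Odd d → ∀ n : ℕ, n + 1 = ⌈t * √d⌉₊ → ∀ a p : Idx d,
      (1 - ε) * (t / √d) ≤ expectedVisits (jumpMatrix d (c₂ * (d : ℝ) ^ β)) a n p := by
  have hmix_lim := tendsto_natCast_mul_exp_neg_rpow (κ := π / (4 * c₂) * (ε / 3 * t))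
    (γ := -(1 / 2) - β) (by positivity) (by linarith)
  have hlarge_lim : Tendsto (fun d : ℕ => ε / 3 * t * √d) atTop atTop :=
    (tendsto_sqrt_atTop.comp tendsto_natCast_atTop_atTop).const_mul_atTop (by positivity)
  filter_upwards [eventually_jumpEigenvalue_le hc₂ (by linarith : β < 0),
    hmix_lim.eventually_le_const (u := ε / 3) (by positivity), hlarge_lim.eventually_ge_atTop 2]
    with d hgap hmix hlarge hd n hn a p
  have hd0 : (0 : ℝ) < d := Nat.cast_pos.mpr hd.pos
  have hσ : 0 < c₂ * (d : ℝ) ^ β := by positivity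
  have hrate : π / (4 * c₂) * (ε / 3 * t) * (d : ℝ) ^ (-(1 / 2) - β) =
      ε / 3 * t * √d * (π / (4 * (c₂ * (d : ℝ) ^ β) * d)) := by
    rw [rpow_sub hd0, rpow_neg hd0.le, ← sqrt_eq_rpow]
    field_simp
    rw [sq_sqrt hd0.le]
  have hpow : rexp (-(π / (4 * (c₂ * (d : ℝ) ^ β) * d))) ^ ⌈ε / 3 * t * √d⌉₊ ≤
      rexp (-(π / (4 * c₂) * (ε / 3 * t) * (d : ℝ) ^ (-(1 / 2) - β))) := by
    rw [← exp_nat_mul, hrate, mul_neg]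
    gcongr
    exact Nat.le_ceil _
  rw [show 1 - ε = 1 - 3 * (ε / 3) by ring]
  exact le_expectedVisits_of_mixing hd hσ (exp_pos _).le (exp_le_one_iff.mpr (by
    rw [neg_nonpos]
    positivity)) hgap ht (by positivity) (by linarith) hlarge
    ((mul_le_mul_of_nonneg_left hpow hd0.le).trans hmix) hn a p

theorem eventually_expectedVisits_le {ρ : ℝ} (hc₂ : 0 < c₂) (ht : 0 < t) (hβ : β < 0)
    (hρ : 0 < ρ) :
    ∀ᶠ d : ℕ in atTop, Odd d → ∀ n : ℕ, n + 1 = ⌈t * √d⌉₊ → ∀ a p : Idx d,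
      expectedVisits (jumpMatrix d (c₂ * (d : ℝ) ^ β)) a n p ≤ ρ := by
  have hlim : Tendsto (fun d : ℕ => t * theta3 0 1 * ((d : ℝ) ^ (-(1 / 2) : ℝ)
      + √(2 * c₂) * (d : ℝ) ^ (β / 2))) atTop (𝓝 0) := by
    simpa using ((tendsto_natCast_rpow_nhds_zero (γ := -(1 / 2)) (by norm_num)).add
      ((tendsto_natCast_rpow_nhds_zero (γ := β / 2) (by linarith)).const_mul
        √(2 * c₂))).const_mul (t * theta3 0 1)
  filter_upwards [hlim.eventually_le_const hρ] with d hρ_ge hd n hn a p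
  have hd0 : (0 : ℝ) < d := Nat.cast_pos.mpr hd.pos
  have hσ : 0 < c₂ * (d : ℝ) ^ β := by positivity
  have hn_le : (n : ℝ) ≤ t * √d := by
    have hceil := Nat.ceil_lt_add_one (by positivity : 0 ≤ t * √d)
    rw [← hn, Nat.cast_succ] at hceil
    linarith
  have hsqrt : √(2 * (c₂ * (d : ℝ) ^ β) * d) = √(2 * c₂) * ((d : ℝ) ^ (β / 2) * √d) := by
    rw [← mul_assoc 2 c₂, mul_assoc (2 * c₂), sqrt_mul (mul_pos two_pos hc₂).le,
      sqrt_mul (rpow_nonneg hd0.le β), sqrt_eq_rpow ((d : ℝ) ^ β), ← rpow_mul hd0.le, mul_one_div]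
  have hθ := theta3_pos one_pos 0
  calc expectedVisits (jumpMatrix d (c₂ * (d : ℝ) ^ β)) a n p
      ≤ n * (theta3 0 1 * (1 + √(2 * (c₂ * (d : ℝ) ^ β) * d)) / d) :=
        expectedVisits_le (jumpMatrix_mem_rowStochastic hd hσ)
          (fun q => jumpProb_le hd.pos hσ _) n p
    _ ≤ t * √d * (theta3 0 1 * (1 + √(2 * (c₂ * (d : ℝ) ^ β) * d)) / d) := by gcongr
    _ = t * theta3 0 1 * ((d : ℝ) ^ (-(1 / 2) : ℝ) + √(2 * c₂) * (d : ℝ) ^ (β / 2)) := by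
        rw [hsqrt, rpow_neg hd0.le, ← sqrt_eq_rpow]
        nth_rw 4 [← sq_sqrt hd0.le]
        field_simp
    _ ≤ ρ := hρ_ge

theorem eventually_hitExpectation_le {c ε : ℝ} (hc₂ : 0 < c₂) (ht : 0 < t) (hβ : β < -(1 / 2))
    (hc : c ∈ Set.Icc (0 : ℝ) 2) (hε : 0 < ε) :
    ∀ᶠ d : ℕ in atTop, ∀ hd : Odd d, ∀ n : ℕ, n + 1 = ⌈t * √d⌉₊ → ∀ p : Idx d,
      hitExpectation (jumpMatrix d (c₂ * (d : ℝ) ^ β)) (lastLabel hd) c n p ≤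
        1 - (1 - ε) * c * (t / √d) := by
  obtain ⟨δ, hδ₀, hδ⟩ := exists_between (lt_min hε one_pos)
  obtain ⟨hδε, hδ₁⟩ := lt_min_iff.mp hδ
  have hβ₀ : β < 0 := by linarith
  filter_upwards [eventually_le_expectedVisits hc₂ ht hβ (half_pos hδ₀) (by linarith),
    eventually_expectedVisits_le hc₂ ht hβ₀ (by positivity : 0 < δ / 4)] with d hmany hfew hd n hn p
  have hd0 : (0 : ℝ) < d := Nat.cast_pos.mpr hd.pos
  have hP := jumpMatrix_mem_rowStochastic hd (σsq := c₂ * (d : ℝ) ^ β) (by positivity)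
  have hu : 0 < t / √d := by positivity
  have hfactor : 1 - δ / 2 ≤ 1 - c * (δ / 4) := by nlinarith [hc.2]
  have hsq : 1 - ε ≤ (1 - δ / 2) * (1 - δ / 2) := by nlinarith
  calc hitExpectation (jumpMatrix d (c₂ * (d : ℝ) ^ β)) (lastLabel hd) c n p
      ≤ 1 - c * (1 - c * (δ / 4)) *
          expectedVisits (jumpMatrix d (c₂ * (d : ℝ) ^ β)) (lastLabel hd) n p :=
        hitExpectation_le hP hc (hfew hd n hn _ _) p
    _ ≤ 1 - c * (1 - δ / 2) * ((1 - δ / 2) * (t / √d)) := by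
        refine sub_le_sub_left (mul_le_mul ?_ (hmany hd n hn _ p) ?_ ?_) 1
        · exact mul_le_mul_of_nonneg_left hfactor hc.1
        · exact mul_nonneg (by linarith) hu.le
        · exact mul_nonneg hc.1 (by linarith)
    _ ≤ 1 - (1 - ε) * c * (t / √d) := by
        nlinarith [mul_le_mul_of_nonneg_right hsq (mul_nonneg hc.1 hu.le)]

theorem eventually_hitExpectation_nonneg {c : ℝ} (hc₂ : 0 < c₂) (ht : 0 < t) (hβ : β < 0)
    (hc : c ∈ Set.Icc (0 : ℝ) 2) :
    ∀ᶠ d : ℕ in atTop, ∀ hd : Odd d, ∀ n : ℕ, n + 1 = ⌈t * √d⌉₊ → ∀ p : Idx d,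
      0 ≤ hitExpectation (jumpMatrix d (c₂ * (d : ℝ) ^ β)) (lastLabel hd) c n p := by
  filter_upwards [eventually_expectedVisits_le hc₂ ht hβ (by norm_num : (0 : ℝ) < 1 / 2)]
    with d hfew hd n hn p
  have hd0 : (0 : ℝ) < d := Nat.cast_pos.mpr hd.pos
  have hP := jumpMatrix_mem_rowStochastic hd (σsq := c₂ * (d : ℝ) ^ β) (by positivity)
  refine le_trans ?_ (one_sub_mul_expectedVisits_le hP (lastLabel hd) hc n p)
  nlinarith [hc.1, hc.2, hfew hd n hn (lastLabel hd) p]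

theorem eventually_abs_hitExpectation_le {c ε : ℝ} (hc₂ : 0 < c₂) (ht : 0 < t)
    (hβ : β < -(1 / 2)) (hc : c ∈ Set.Icc (0 : ℝ) 2) (hε : 0 < ε) :
    ∀ᶠ d : ℕ in atTop, ∀ hd : Odd d, ∀ n : ℕ, n + 1 = ⌈t * √d⌉₊ → ∀ p : Idx d,
      |hitExpectation (jumpMatrix d (c₂ * (d : ℝ) ^ β)) (lastLabel hd) c n p| ≤
        1 - (1 - ε) * c * (t / √d) := by
  have hβ₀ : β < 0 := by linarith
  filter_upwards [eventually_hitExpectation_le hc₂ ht hβ hc hε,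
    eventually_hitExpectation_nonneg hc₂ ht hβ₀ hc] with d hle hnonneg hd n hn p
  rw [abs_of_nonneg (hnonneg hd n hn p)]
  exact hle hd n hn p

theorem eventually_walkExpectation_antipodeProduct_le {c ε : ℝ} (hc₂ : 0 < c₂) (ht : 0 < t)
    (hβ : β < -(1 / 2)) (hc : c ∈ Set.Icc (0 : ℝ) 2) (hε : 0 < ε) :
    ∀ᶠ d : ℕ in atTop, Odd d → ∀ n : ℕ, n + 1 = ⌈t * √d⌉₊ → ∀ p : Idx d,
      walkExpectation d (c₂ * (d : ℝ) ^ β) n p (antipodeProduct d c n) ≤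
        1 - (1 - ε) * c * (t / √d) := by
  filter_upwards [eventually_abs_hitExpectation_le hc₂ ht hβ hc hε] with d hle hd n hn p
  rw [walkExpectation_antipodeProduct hd]
  refine (le_abs_self _).trans ?_
  rw [abs_mul]
  exact (mul_le_of_le_one_left (abs_nonneg _) (abs_hitFactor_le_one _ hc p)).trans (hle hd n hn p)

end Asymptotics

section Parseval

theorem integral_fourierChar_mul_div {L : ℝ} (hL : 0 < L) (k : ℤ) :
    ∫ x in Set.Icc (-(L / 2)) (L / 2), (𝐞 (k * x / L) : ℂ) = if k = 0 then (L : ℂ) else 0 := by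
  rw [MeasureTheory.integral_Icc_eq_integral_Ioc, ← intervalIntegral.integral_of_le (by linarith)]
  split_ifs with hk
  · simp [hk]
  · have hc : (2 * π * Complex.I * k / L : ℂ) ≠ 0 :=
      div_ne_zero (mul_ne_zero Complex.two_pi_I_ne_zero (by exact_mod_cast hk))
        (by exact_mod_cast hL.ne')
    have hexp (x : ℝ) : (𝐞 (k * x / L) : ℂ) = Complex.exp (2 * π * Complex.I * k / L * x) := by
      rw [fourierChar_apply]
      congr 1
      push_cast
      ring
    have hperiod : (k : ℝ) * (L / 2) / L = k * (-(L / 2)) / L + k := by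
      field_simp
      ring
    simp only [hexp]
    rw [integral_exp_mul_complex hc, ← hexp, ← hexp, hperiod, fourierChar_add_intCast, sub_self,
      zero_div]

theorem hasSum_prod_mul {ι κ : Type*} {f : ι → ℂ} {g : κ → ℂ} {F G : ℂ} (hF : HasSum f F)
    (hG : HasSum g G) : HasSum (fun q : ι × κ => f q.1 * g q.2) (F * G) :=
  hF.mul hG (summable_mul_of_summable_norm hF.summable.norm hG.summable.norm)

theorem hasSum_fourierChar_mul_conj_mul {L x : ℝ} (r : ℤ) {f g : ℤ → ℂ} {F G : ℂ}
    (hF : HasSum (fun m : ℤ => f m * 𝐞 (-(m * x / L))) F)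
    (hG : HasSum (fun m : ℤ => g m * 𝐞 (-(m * x / L))) G) :
    HasSum (fun q : ℤ × ℤ => conj (f q.1) * g q.2 * 𝐞 (((r + q.1 - q.2 : ℤ) : ℝ) * x / L))
      (𝐞 (r * x / L) * (conj F * G)) := by
  refine ((hasSum_prod_mul (Complex.hasSum_conj'.mpr hF) hG).mul_left _).congr_fun fun q => ?_
  have hsplit : ((r + q.1 - q.2 : ℤ) : ℝ) * x / L = r * x / L + (q.1 * x / L + -(q.2 * x / L)) := by
    push_cast
    ring
  rw [hsplit, coe_fourierChar_add, coe_fourierChar_add, map_mul, conj_fourierChar, neg_neg]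
  ring

theorem hasSum_integral_fourierChar_mul_conj_mul {L : ℝ} (hL : 0 < L) (r : ℤ) {f g : ℤ → ℂ}
    {F G : ℝ → ℂ} (hF : ∀ x, HasSum (fun m : ℤ => f m * 𝐞 (-(m * x / L))) (F x))
    (hG : ∀ x, HasSum (fun m : ℤ => g m * 𝐞 (-(m * x / L))) (G x)) :
    HasSum (fun m => (L : ℂ) * (conj (f m) * g (m + r)))
      (∫ x in Set.Icc (-(L / 2)) (L / 2), 𝐞 (r * x / L) * (conj (F x) * G x)) := by
  have hf : Summable f := by simpa using (hF 0).summable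
  have hg : Summable g := by simpa using (hG 0).summable
  have hsum := MeasureTheory.hasSum_integral_of_summable_integral_norm
    (μ := MeasureTheory.volume.restrict (Set.Icc (-(L / 2)) (L / 2)))
    (F := fun (q : ℤ × ℤ) x => conj (f q.1) * g q.2 * 𝐞 (((r + q.1 - q.2 : ℤ) : ℝ) * x / L))
    (fun q => Continuous.integrableOn_Icc (by fun_prop)) (by
      simp only [norm_mul, RCLike.norm_conj, Circle.norm_coe, mul_one,
        MeasureTheory.integral_const, smul_eq_mul]
      exact (summable_mul_of_summable_norm hf.norm.norm hg.norm.norm).mul_left _)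
  simp only [fun x => (hasSum_fourierChar_mul_conj_mul r (hF x) (hG x)).tsum_eq,
    MeasureTheory.integral_const_mul, integral_fourierChar_mul_div hL] at hsum
  have hinj : Function.Injective fun m : ℤ => (m, m + r) := fun _ _ h => (Prod.ext_iff.mp h).1
  rw [← hinj.hasSum_iff] at hsum
  · refine hsum.congr_fun fun m => ?_
    simp only [Function.comp_apply]
    rw [if_pos (by ring), mul_comm]
  · intro q hq
    rw [if_neg, mul_zero]
    exact fun h => hq ⟨q.1, Prod.ext rfl (by simp only; linarith)⟩

end Parseval

section TimeBasis

variable {d : ℕ}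

theorem timeState_apply (k n : Idx d) :
    timeState d k n = 1 / (√d : ℂ) * 𝐞 (-(((k : ℤ) : ℝ) * (n : ℤ) / d)) := by
  rw [timeState, fourierChar_apply]
  congr 2
  push_cast
  ring

theorem timeState_comm (k n : Idx d) : timeState d k n = timeState d n k := by
  rw [timeState_apply, timeState_apply, mul_comm ((k : ℤ) : ℝ)]

theorem timeState_mul_conj (k n n' : Idx d) :
    timeState d k n * conj (timeState d k n') =
      1 / (d : ℂ) * 𝐞 (((k : ℤ) : ℝ) * (((n' : ℤ) : ℝ) - (n : ℤ)) / d) := by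
  have hsq : 1 / (√d : ℂ) * (1 / (√d : ℂ)) = 1 / d := by
    rw [div_mul_div_comm, one_mul, ← Complex.ofReal_mul, mul_self_sqrt d.cast_nonneg,
      Complex.ofReal_natCast]
  rw [timeState_apply, timeState_apply, map_mul, conj_fourierChar, neg_neg, map_div₀, map_one,
    Complex.conj_ofReal, mul_mul_mul_comm, hsq, ← coe_fourierChar_add]
  congr 3
  ring

/-- The operator `∑_k e^{2πimk/d} |θ_k⟩⟨θ_k|` is the cyclic shift of the energy basis by `m`. -/
theorem sum_fourierChar_mul_timeState_mul_conj (hd : Odd d) (m : ℤ) (n n' : Idx d) :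
    ∑ k : Idx d, 𝐞 (m * (k : ℤ) / d) * (timeState d k n * conj (timeState d k n')) =
      if n' = wrap hd (n + -m) then 1 else 0 := by
  have hd0 : (d : ℂ) ≠ 0 := Nat.cast_ne_zero.mpr hd.pos.ne'
  have hsum := sum_fourierChar_mul_div hd ((n' : ℤ) - (n + -m))
  simp only [← wrap_eq_wrap_iff hd, wrap_coe] at hsum
  calc ∑ k : Idx d, 𝐞 (m * (k : ℤ) / d) * (timeState d k n * conj (timeState d k n'))
      = 1 / (d : ℂ) * ∑ k : Idx d, (𝐞 ((((n' : ℤ) - (n + -m) : ℤ) : ℝ) * (k : ℤ) / d) : ℂ) := by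
        rw [Finset.mul_sum]
        refine Finset.sum_congr rfl fun k _ => ?_
        rw [timeState_mul_conj, mul_left_comm, ← coe_fourierChar_add]
        congr 3
        push_cast
        ring
    _ = if n' = wrap hd (n + -m) then 1 else 0 := by
        rw [hsum, mul_ite, mul_zero, one_div_mul_cancel hd0]

theorem sum_timeState_mul_conj (hd : Odd d) (k k' : Idx d) :
    ∑ n : Idx d, timeState d k' n * conj (timeState d k n) = if k = k' then 1 else 0 := by
  simpa [wrap_coe, timeState_comm k, timeState_comm k'] using
    sum_fourierChar_mul_timeState_mul_conj hd 0 k' k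

end TimeBasis

section Kraus

variable {d : ℕ} {σsq : ℝ}

/-- The prefactor `d^{-1/4} θ₃(0, 2iσ²/d)^{-1/2}` of the Kraus operators. -/
def krausNorm (d : ℕ) (σsq : ℝ) : ℝ :=
  1 / √(theta3 0 (2 * σsq / d)) * (1 / (d : ℝ) ^ (1 / 4 : ℝ))

theorem sqrt_mul_krausNorm_sq (hd : 0 < d) (hσ : 0 < σsq) :
    √d * krausNorm d σsq ^ 2 = 1 / theta3 0 (2 * σsq / d) := by
  have hθ := theta3_pos (by positivity : 0 < 2 * σsq / d) 0
  have hroot : ((d : ℝ) ^ (1 / 4 : ℝ)) ^ 2 = √d := by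
    rw [← rpow_mul_natCast d.cast_nonneg, sqrt_eq_rpow]
    norm_num
  have : 0 < √(d : ℝ) := by positivity
  rw [krausNorm, mul_pow, div_pow, div_pow, hroot, sq_sqrt hθ.le]
  field_simp

theorem hasSum_krausCoeff (hd : 0 < d) (hσ : 0 < σsq) (x : ℝ) (k : Idx d) :
    HasSum (fun m : ℤ => ((krausNorm d σsq * gaussWeight (σsq / d) m : ℝ) : ℂ) *
        𝐞 (-(m * x / √d)) * 𝐞 (m * (k : ℤ) / d))
      (krausCoeff d σsq x k) := by
  have hd0 : (0 : ℝ) < d := Nat.cast_pos.mpr hd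
  have hsum := (hasSum_theta3 (div_pos hσ hd0) ((((k : ℤ) : ℝ) - x * √d) / d)).mul_left
    (krausNorm d σsq : ℂ)
  rw [← Complex.ofReal_mul] at hsum
  refine hsum.congr_fun fun m => ?_
  have hphase : (m : ℝ) * ((((k : ℤ) : ℝ) - x * √d) / d) = -(m * x / √d) + m * (k : ℤ) / d := by
    nth_rw 2 4 [← sq_sqrt hd0.le]
    field_simp
    ring
  rw [hphase, coe_fourierChar_add]
  push_cast
  ring

theorem kraus_mulVec_apply (x : ℝ) (v : Idx d → ℂ) (n : Idx d) :
    (kraus d σsq x *ᵥ v) n =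
      ∑ n', ∑ k, krausCoeff d σsq x k * (timeState d k n * conj (timeState d k n')) * v n' := by
  rw [Matrix.mulVec, dotProduct]
  refine Finset.sum_congr rfl fun n' _ => ?_
  rw [kraus, Matrix.sum_apply, Finset.sum_mul]
  simp only [Matrix.smul_apply, Matrix.vecMulVec_apply, Pi.star_apply, RCLike.star_def, smul_eq_mul]

theorem hasSum_kraus_mulVec (hd : Odd d) (hσ : 0 < σsq) (x : ℝ) (v : Idx d → ℂ) (n : Idx d) :
    HasSum (fun m : ℤ => ((krausNorm d σsq * gaussWeight (σsq / d) m : ℝ) : ℂ) *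
        v (wrap hd (n + -m)) * 𝐞 (-(m * x / √d)))
      ((kraus d σsq x *ᵥ v) n) := by
  rw [kraus_mulVec_apply]
  refine (hasSum_sum fun n' _ => hasSum_sum fun k _ =>
    ((hasSum_krausCoeff hd.pos hσ x k).mul_right _).mul_right _).congr_fun fun m => ?_
  have hshift (n' : Idx d) :
      ∑ k : Idx d, ((krausNorm d σsq * gaussWeight (σsq / d) m : ℝ) : ℂ) * 𝐞 (-(m * x / √d)) *
          𝐞 (m * (k : ℤ) / d) * (timeState d k n * conj (timeState d k n')) * v n' =
        ((krausNorm d σsq * gaussWeight (σsq / d) m : ℝ) : ℂ) * 𝐞 (-(m * x / √d)) *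
          (if n' = wrap hd (n + -m) then 1 else 0) * v n' := by
    rw [← sum_fourierChar_mul_timeState_mul_conj hd, Finset.mul_sum, Finset.sum_mul]
    simp only [mul_assoc]
  simp only [hshift, mul_ite, mul_one, mul_zero, ite_mul, zero_mul, Finset.sum_ite_eq',
    Finset.mem_univ, if_true]
  ring

theorem continuous_krausCoeff (hd : 0 < d) (hσ : 0 < σsq) (k : Idx d) :
    Continuous fun x => krausCoeff d σsq x k := by
  have hθ := continuous_theta3 (by positivity : 0 < σsq / d)
  unfold krausCoeff
  fun_prop

theorem continuous_kraus (hd : 0 < d) (hσ : 0 < σsq) : Continuous (kraus d σsq) :=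
  continuous_finsetSum _ fun k _ =>
    (Complex.continuous_ofReal.comp (continuous_krausCoeff hd hσ k)).smul continuous_const

end Kraus

section ShiftForm

variable {d : ℕ} {σsq : ℝ}

/-- The sesquilinear expression `⟨v, S^{-a} G v⟩`, where `S|n⟩ = |n+1⟩` is the cyclic shift of the
energy basis and `G` is diagonal in it. -/
def shiftForm (hd : Odd d) (a : ℤ) (G : Idx d → ℝ) (v : Idx d → ℂ) : ℂ :=
  ∑ n : Idx d, conj (v (wrap hd (n + a))) * v n * G n

theorem continuous_shiftForm (hd : Odd d) (a : ℤ) (G : Idx d → ℝ) :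
    Continuous (shiftForm hd a G) := by
  unfold shiftForm
  fun_prop

theorem shiftForm_zero_one (hd : Odd d) (v : Idx d → ℂ) :
    shiftForm hd 0 1 v = ((∑ n, ‖v n‖ ^ 2 : ℝ) : ℂ) := by
  simp only [shiftForm, add_zero, wrap_coe, Complex.conj_mul', Pi.one_apply, Complex.ofReal_one,
    mul_one]
  push_cast
  rfl

theorem norm_shiftForm_le (hd : Odd d) (a : ℤ) {G : Idx d → ℝ} {M : ℝ} (hG : ∀ n, |G n| ≤ M)
    (v : Idx d → ℂ) : ‖shiftForm hd a G v‖ ≤ M * ∑ n, ‖v n‖ ^ 2 := by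
  have hshift : ∑ n : Idx d, ‖v (wrap hd (n + a))‖ ^ 2 = ∑ n, ‖v n‖ ^ 2 :=
    (shiftEquiv hd a).sum_comp fun n => ‖v n‖ ^ 2
  have hterm (n : Idx d) : ‖conj (v (wrap hd (n + a))) * v n * G n‖ ≤
      M * (1 / 2 * ‖v (wrap hd (n + a))‖ ^ 2 + 1 / 2 * ‖v n‖ ^ 2) := by
    rw [norm_mul, norm_mul, RCLike.norm_conj, Complex.norm_real, norm_eq_abs, mul_comm]
    refine mul_le_mul (hG n) ?_ (by positivity) ((abs_nonneg _).trans (hG n))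
    linarith [two_mul_le_add_sq ‖v (wrap hd (n + a))‖ ‖v n‖]
  calc ‖shiftForm hd a G v‖
      ≤ ∑ n : Idx d, M * (1 / 2 * ‖v (wrap hd (n + a))‖ ^ 2 + 1 / 2 * ‖v n‖ ^ 2) :=
        norm_sum_le_of_le _ fun n _ => hterm n
    _ = M * ∑ n, ‖v n‖ ^ 2 := by
        rw [← Finset.mul_sum, Finset.sum_add_distrib, ← Finset.mul_sum, ← Finset.mul_sum, hshift]
        ring

/-- The product of the `m`-th and `(m+r)`-th Fourier coefficients of the Kraus operators, integrated
over the outcomes. -/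
def overlapWeight (d : ℕ) (σsq : ℝ) (r m : ℤ) : ℝ :=
  gaussWeight (σsq / d) m * gaussWeight (σsq / d) (m + r) / theta3 0 (2 * σsq / d)

theorem overlapWeight_zero (m : ℤ) : overlapWeight d σsq 0 m = jumpWeight d σsq m := by
  rw [overlapWeight, jumpWeight, add_zero, ← sq, gaussWeight_sq, mul_div_assoc]

theorem overlapWeight_nonneg (hd : 0 < d) (hσ : 0 < σsq) (r m : ℤ) :
    0 ≤ overlapWeight d σsq r m :=
  (div_pos (mul_pos (gaussWeight_pos _ _) (gaussWeight_pos _ _))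
    (theta3_pos (by positivity) 0)).le

theorem overlapWeight_le (hd : 0 < d) (hσ : 0 < σsq) (r m : ℤ) :
    overlapWeight d σsq r m ≤ 1 / 2 * (jumpWeight d σsq m + jumpWeight d σsq (m + r)) := by
  have hθ := theta3_pos (by positivity : 0 < 2 * σsq / d) 0
  have hsq (n : ℤ) : gaussWeight (2 * σsq / d) n = gaussWeight (σsq / d) n ^ 2 := by
    rw [gaussWeight_sq, mul_div_assoc]
  rw [overlapWeight, jumpWeight, jumpWeight, ← add_div, ← mul_div_assoc, hsq, hsq]
  refine div_le_div_of_nonneg_right ?_ hθ.le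
  linarith [two_mul_le_add_sq (gaussWeight (σsq / d) m) (gaussWeight (σsq / d) (m + r))]

theorem hasSum_average_jumpWeight (hd : 0 < d) (hσ : 0 < σsq) (r : ℤ) :
    HasSum (fun m => 1 / 2 * (jumpWeight d σsq m + jumpWeight d σsq (m + r))) 1 := by
  have hsum := hasSum_jumpWeight hd hσ
  have hadd := (hsum.add ((Equiv.addRight r).hasSum_iff.mpr hsum)).mul_left (1 / 2)
  rwa [one_add_one_eq_two, one_div_mul_cancel two_ne_zero] at hadd

/-- The `r`-th Fourier coefficient of the outcome distribution in a fixed time eigenstate. -/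
def outcomeCoeff (d : ℕ) (σsq : ℝ) (r : ℤ) : ℝ := ∑' m : ℤ, overlapWeight d σsq r m

theorem hasSum_overlapWeight (hd : 0 < d) (hσ : 0 < σsq) (r : ℤ) :
    HasSum (overlapWeight d σsq r) (outcomeCoeff d σsq r) :=
  (Summable.of_nonneg_of_le (overlapWeight_nonneg hd hσ r) (overlapWeight_le hd hσ r)
    (hasSum_average_jumpWeight hd hσ r).summable).hasSum

theorem abs_outcomeCoeff_le (hd : 0 < d) (hσ : 0 < σsq) (r : ℤ) : |outcomeCoeff d σsq r| ≤ 1 := by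
  rw [outcomeCoeff, abs_of_nonneg (tsum_nonneg (overlapWeight_nonneg hd hσ r))]
  exact hasSum_le (overlapWeight_le hd hσ r) (hasSum_overlapWeight hd hσ r)
    (hasSum_average_jumpWeight hd hσ r)

theorem hasSum_integral_kraus (hd : Odd d) (hσ : 0 < σsq) (r : ℤ) (v : Idx d → ℂ) (n n' : Idx d) :
    HasSum (fun m : ℤ => (overlapWeight d σsq r m : ℂ) *
        (conj (v (wrap hd (n + -m))) * v (wrap hd (n' + -(m + r)))))
      (∫ x in Set.Icc (-(√d / 2)) (√d / 2), 𝐞 (r * x / √d) *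
        (conj ((kraus d σsq x *ᵥ v) n) * (kraus d σsq x *ᵥ v) n')) := by
  have hsum := hasSum_integral_fourierChar_mul_conj_mul
    (sqrt_pos.mpr (Nat.cast_pos.mpr hd.pos)) r
    (fun x => hasSum_kraus_mulVec hd hσ x v n) (fun x => hasSum_kraus_mulVec hd hσ x v n')
  refine hsum.congr_fun fun m => ?_
  rw [overlapWeight, ← mul_one_div, ← sqrt_mul_krausNorm_sq hd.pos hσ, map_mul, Complex.conj_ofReal]
  push_cast
  ring

theorem integrableOn_kraus (hd : 0 < d) (hσ : 0 < σsq) (r : ℤ) (v : Idx d → ℂ) (n n' : Idx d) :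
    MeasureTheory.IntegrableOn (fun x => 𝐞 (r * x / √d) *
        (conj ((kraus d σsq x *ᵥ v) n) * (kraus d σsq x *ᵥ v) n'))
      (Set.Icc (-(√d / 2)) (√d / 2)) := by
  have hkraus : Continuous fun x => kraus d σsq x *ᵥ v :=
    (continuous_kraus hd hσ).matrix_mulVec continuous_const
  exact Continuous.integrableOn_Icc (by fun_prop)

theorem hasSum_integral_shiftForm_kraus (hd : Odd d) (hσ : 0 < σsq) (r a : ℤ) (G : Idx d → ℝ)
    (v : Idx d → ℂ) :
    HasSum (fun m : ℤ => (overlapWeight d σsq r m : ℂ) *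
        shiftForm hd (a + r) (fun p => G (wrap hd (p + (m + r)))) v)
      (∫ x in Set.Icc (-(√d / 2)) (√d / 2),
        𝐞 (r * x / √d) * shiftForm hd a G (kraus d σsq x *ᵥ v)) := by
  have hexpand : ∫ x in Set.Icc (-(√d / 2)) (√d / 2),
        𝐞 (r * x / √d) * shiftForm hd a G (kraus d σsq x *ᵥ v) =
      ∑ n : Idx d, (∫ x in Set.Icc (-(√d / 2)) (√d / 2), 𝐞 (r * x / √d) *
        (conj ((kraus d σsq x *ᵥ v) (wrap hd (n + a))) * (kraus d σsq x *ᵥ v) n)) * G n := by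
    simp only [shiftForm, Finset.mul_sum, ← MeasureTheory.integral_mul_const, mul_assoc]
    refine MeasureTheory.integral_finsetSum _ fun n _ => ?_
    simpa only [mul_assoc] using
      (integrableOn_kraus hd.pos hσ r v (wrap hd (n + a)) n).mul_const (G n : ℂ)
  rw [hexpand]
  refine (hasSum_sum fun (n : Idx d) _ => (hasSum_integral_kraus hd hσ r v
    (wrap hd (n + a)) n).mul_right (G n : ℂ)).congr_fun fun m => ?_
  rw [shiftForm, Finset.mul_sum]
  conv_rhs => rw [← (shiftEquiv hd (m + r)).sum_comp]
  refine Finset.sum_congr rfl fun p _ => ?_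
  have hleft : (p : ℤ) + (m + r) + (a + -m) = p + (a + r) := by ring
  rw [shiftEquiv_apply, wrap_wrap_add hd _ a, wrap_wrap_add hd _ (-m),
    wrap_wrap_add hd _ (-(m + r)), add_assoc _ a, hleft, add_neg_cancel_right, wrap_coe]
  ring

theorem integral_shiftForm_kraus (hd : Odd d) (hσ : 0 < σsq) (a : ℤ) (G : Idx d → ℝ)
    (v : Idx d → ℂ) :
    ∫ x in Set.Icc (-(√d / 2)) (√d / 2), shiftForm hd a G (kraus d σsq x *ᵥ v) =
      shiftForm hd a (jumpMatrix d σsq *ᵥ G) v := by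
  have hsum := hasSum_integral_shiftForm_kraus hd hσ 0 a G v
  simp only [Int.cast_zero, zero_mul, zero_div, AddChar.map_zero_eq_one, Circle.coe_one, one_mul,
    add_zero, overlapWeight_zero] at hsum
  have htransition (p : Idx d) : HasSum
      (fun m : ℤ => conj (v (wrap hd (p + a))) * v p * (jumpWeight d σsq m * G (wrap hd (p + m))))
      (conj (v (wrap hd (p + a))) * v p * ((jumpMatrix d σsq *ᵥ G) p : ℂ)) := by
    refine HasSum.mul_left _ ?_
    simpa [Matrix.mulVec, dotProduct, jumpMatrix_apply] using
      hasSum_jumpWeight_mul_wrap hd hσ (fun q => (G q : ℂ)) p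
  refine hsum.unique ((hasSum_sum fun p _ => htransition p).congr_fun fun m => ?_)
  rw [shiftForm, Finset.mul_sum]
  exact Finset.sum_congr rfl fun p _ => by ring

theorem integral_fourierChar_mul_shiftForm_kraus (hd : Odd d) (hσ : 0 < σsq) (r a : ℤ)
    (v : Idx d → ℂ) :
    ∫ x in Set.Icc (-(√d / 2)) (√d / 2), 𝐞 (r * x / √d) * shiftForm hd a 1 (kraus d σsq x *ᵥ v) =
      outcomeCoeff d σsq r * shiftForm hd (a + r) 1 v := by
  refine (hasSum_integral_shiftForm_kraus hd hσ r a 1 v).unique ?_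
  exact (Complex.hasSum_ofReal.mpr (hasSum_overlapWeight hd.pos hσ r)).mul_right
    (shiftForm hd (a + r) 1 v)

end ShiftForm

section Evolution

variable {d : ℕ}

theorem evolution_mulVec (hd : 0 < d) (δ : ℝ) (v : Idx d → ℂ) (n : Idx d) :
    (evolution d (δ / √d) *ᵥ v) n = 𝐞 (-((n : ℤ) * δ / d)) * v n := by
  have hsqrt : √(d : ℝ) ≠ 0 := (sqrt_pos.mpr (Nat.cast_pos.mpr hd)).ne'
  have hphase : δ / √d * (2 * π / √d * (n : ℤ)) = 2 * π * ((n : ℤ) * δ / d) := by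
    nth_rw 3 [← sq_sqrt d.cast_nonneg]
    field_simp
  rw [evolution, hamiltonian, ← Matrix.diagonal_smul, Matrix.exp_diagonal, Matrix.mulVec_diagonal,
    Pi.coe_exp, ← Complex.exp_eq_exp_ℂ, fourierChar_apply, Pi.smul_apply, smul_eq_mul,
    mul_neg, ← hphase]
  congr 2
  push_cast
  ring

theorem shiftForm_zero_evolution (hd : Odd d) (δ : ℝ) (G : Idx d → ℝ) (v : Idx d → ℂ) :
    shiftForm hd 0 G (evolution d (δ / √d) *ᵥ v) = shiftForm hd 0 G v := by
  simp only [shiftForm, add_zero, wrap_coe, evolution_mulVec hd.pos, Complex.conj_mul', norm_mul,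
    Circle.norm_coe, one_mul]

theorem wrap_add_one_sub (hd : Odd d) (n : Idx d) :
    ((wrap hd (n + 1) : ℤ) : ℝ) - (n : ℤ) = 1 - d * if n = lastLabel hd then 1 else 0 := by
  have hn := Finset.mem_Icc.mp n.2
  have hwrap : (wrap hd (n + 1) : ℤ) - n = 1 - d * if n = lastLabel hd then 1 else 0 := by
    simp only [Subtype.ext_iff, lastLabel, wrap]
    obtain ⟨e, rfl⟩ := hd
    split_ifs with hlast
    · rw [← Int.sub_bmod_right, Int.bmod_eq_of_le] <;> omega
    · rw [Int.bmod_eq_of_le] <;> omega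
  exact_mod_cast hwrap

theorem fourierChar_neg_half : (𝐞 (-(1 / 2)) : ℂ) = -1 := by
  rw [fourierChar_apply, ← Complex.exp_neg_pi_mul_I]
  congr 1
  push_cast
  ring

/-- For `δ = 1/2` a wrap-around of the energy label contributes the phase `e^{-iπ} = -1`, which is
`1 - 2 · 1` at the last label. -/
theorem shiftForm_one_evolution_half (hd : Odd d) (G : Idx d → ℝ) (v : Idx d → ℂ) :
    shiftForm hd 1 G (evolution d (1 / 2 / √d) *ᵥ v) =
      𝐞 (1 / (2 * d)) * shiftForm hd 1 (hitFactor (lastLabel hd) 2 * G) v := by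
  have hd0 : (d : ℝ) ≠ 0 := Nat.cast_ne_zero.mpr hd.pos.ne'
  have hphase (n : Idx d) : (𝐞 ((wrap hd (n + 1) : ℤ) * (1 / 2) / d) : ℂ) *
      𝐞 (-((n : ℤ) * (1 / 2) / d)) = 𝐞 (1 / (2 * d)) * hitFactor (lastLabel hd) 2 n := by
    have hdiff : ((wrap hd (n + 1) : ℤ) : ℝ) * (1 / 2) / d + -((n : ℤ) * (1 / 2) / d) =
        1 / (2 * d) + if n = lastLabel hd then -(1 / 2) else 0 := by
      rw [← sub_eq_add_neg, ← sub_div, ← sub_mul, wrap_add_one_sub]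
      split_ifs <;> field_simp <;> ring
    rw [← coe_fourierChar_add, hdiff, coe_fourierChar_add, hitFactor]
    split_ifs
    · rw [fourierChar_neg_half]
      norm_num
    · simp
  rw [shiftForm, shiftForm, Finset.mul_sum]
  refine Finset.sum_congr rfl fun n _ => ?_
  rw [evolution_mulVec hd.pos, evolution_mulVec hd.pos, map_mul, conj_fourierChar, neg_neg,
    mul_mul_mul_comm, hphase, Pi.mul_apply]
  push_cast
  ring

end Evolution

section InitialState

variable {d : ℕ} {ξsq : ℝ}

theorem one_add_fourierChar_div_two (n : ℤ) :
    1 + (𝐞 ((n : ℝ) / 2) : ℂ) = if Even n then 2 else 0 := by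
  obtain ⟨k, rfl | rfl⟩ := n.even_or_odd'
  · rw [if_pos (even_two_mul k), Int.cast_mul, Int.cast_two, mul_div_cancel_left₀ _ two_ne_zero,
      fourierChar_intCast, Circle.coe_one, one_add_one_eq_two]
  · have hshift : ((2 * k + 1 : ℤ) : ℝ) / 2 = -(1 / 2) + (k + 1 : ℤ) := by
      push_cast
      ring
    rw [if_neg (Int.not_even_two_mul_add_one k), hshift, fourierChar_add_intCast,
      fourierChar_neg_half, add_neg_cancel]

theorem hasSum_theta3_mul {s t : ℝ} (hs : 0 < s) (ht : 0 < t) (z w : ℝ) :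
    HasSum (fun q : ℤ × ℤ => ((gaussWeight s q.1 * gaussWeight t q.2 : ℝ) : ℂ) *
      𝐞 (q.1 * z + q.2 * w)) (theta3 z s * theta3 w t) := by
  refine (hasSum_prod_mul (hasSum_theta3 hs z) (hasSum_theta3 ht w)).congr_fun fun q => ?_
  rw [coe_fourierChar_add]
  push_cast
  ring

theorem hasSum_sum_theta3_sq (hd : Odd d) {s : ℝ} (hs : 0 < s) :
    HasSum (fun q : ℤ × ℤ => ((gaussWeight s q.1 * gaussWeight s (d * q.2 - q.1) : ℝ) : ℂ) * d)
      ((∑ k : Idx d, theta3 ((k : ℤ) / d) s ^ 2 : ℝ) : ℂ) := by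
  have hpairs : HasSum (fun q : ℤ × ℤ => ((gaussWeight s q.1 * gaussWeight s q.2 : ℝ) : ℂ) *
      if (d : ℤ) ∣ q.1 + q.2 then (d : ℂ) else 0)
      ((∑ k : Idx d, theta3 ((k : ℤ) / d) s ^ 2 : ℝ) : ℂ) := by
    push_cast
    simp only [sq]
    refine (hasSum_sum fun (k : Idx d) _ => hasSum_theta3_mul hs hs ((k : ℤ) / d)
      ((k : ℤ) / d)).congr_fun fun q => ?_
    rw [← sum_fourierChar_mul_div hd, Finset.mul_sum]
    refine Finset.sum_congr rfl fun k _ => ?_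
    rw [← Complex.ofReal_mul]
    congr 3
    push_cast
    ring
  have hinj : Function.Injective fun q : ℤ × ℤ => (q.1, d * q.2 - q.1) := by
    rintro ⟨m, n⟩ ⟨m', n'⟩ heq
    obtain ⟨rfl, hn⟩ := Prod.mk.inj heq
    exact congrArg _ (mul_left_cancel₀ (Nat.cast_ne_zero.mpr hd.pos.ne') (sub_left_injective hn))
  rw [← hinj.hasSum_iff] at hpairs
  · simpa [Function.comp_def] using hpairs
  · rintro ⟨m, n⟩ hrange
    refine mul_eq_zero_of_right _ (if_neg ?_)
    rintro ⟨k, hk⟩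
    exact hrange ⟨(m, k), Prod.ext rfl (sub_eq_of_eq_add' hk.symm)⟩

theorem hasSum_theta3_mul_add_theta3_mul (d : ℕ) {s t : ℝ} (hs : 0 < s) (ht : 0 < t) :
    HasSum (fun q : ℤ × ℤ => ((gaussWeight s (2 * q.1 - d * q.2) * gaussWeight t q.2 : ℝ) : ℂ) * 2)
      ((theta3 0 s * theta3 0 t + theta3 (1 / 2) s * theta3 (d / 2) t : ℝ) : ℂ) := by
  have hpairs : HasSum (fun q : ℤ × ℤ => ((gaussWeight s q.1 * gaussWeight t q.2 : ℝ) : ℂ) *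
      if Even (q.1 + d * q.2) then 2 else 0)
      ((theta3 0 s * theta3 0 t + theta3 (1 / 2) s * theta3 (d / 2) t : ℝ) : ℂ) := by
    push_cast
    refine ((hasSum_theta3_mul hs ht 0 0).add
      (hasSum_theta3_mul hs ht (1 / 2) (d / 2))).congr_fun fun q => ?_
    rw [← one_add_fourierChar_div_two, mul_zero, mul_zero, add_zero, AddChar.map_zero_eq_one,
      Circle.coe_one, ← mul_add, ← Complex.ofReal_mul]
    congr 4
    push_cast
    ring
  have hinj : Function.Injective fun q : ℤ × ℤ => (2 * q.1 - d * q.2, q.2) := by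
    rintro ⟨m, n⟩ ⟨m', n'⟩ heq
    obtain ⟨hm, rfl⟩ := Prod.mk.inj heq
    simpa using hm
  rw [← hinj.hasSum_iff] at hpairs
  · simpa [Function.comp_def] using hpairs
  · rintro ⟨m, n⟩ hrange
    refine mul_eq_zero_of_right _ (if_neg ?_)
    rintro ⟨k, hk⟩
    exact hrange ⟨(k, n), Prod.ext (sub_eq_of_eq_add (by rw [two_mul, hk])) rfl⟩

theorem gaussWeight_mul_gaussWeight_sub (hd : 0 < d) (m n : ℤ) :
    gaussWeight (ξsq / d) m * gaussWeight (ξsq / d) (d * n - m) =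
      gaussWeight (ξsq / (2 * d)) (2 * m - d * n) * gaussWeight (d * ξsq / 2) n := by
  have hd0 : (d : ℝ) ≠ 0 := Nat.cast_ne_zero.mpr hd.ne'
  simp only [gaussWeight, ← exp_add]
  congr 1
  push_cast
  field_simp
  ring

/-- Both sides are the same Gaussian sum over `ℤ²`: with a constraint modulo `d` on the left and a
parity constraint on the right, matched by `(m, d n - m) ↔ (2 m - d n, n)`. -/
theorem two_mul_sum_theta3_sq (hd : Odd d) (hξ : 0 < ξsq) :
    2 * ∑ k : Idx d, theta3 ((k : ℤ) / d) (ξsq / d) ^ 2 =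
      d * (theta3 0 (ξsq / (2 * d)) * theta3 0 (d * ξsq / 2) +
        theta3 (1 / 2) (ξsq / (2 * d)) * theta3 (d / 2) (d * ξsq / 2)) := by
  have hd0 : (0 : ℝ) < d := Nat.cast_pos.mpr hd.pos
  have hresidue := (hasSum_sum_theta3_sq hd (by positivity : 0 < ξsq / d)).mul_left 2
  have hparity := (hasSum_theta3_mul_add_theta3_mul d (by positivity : 0 < ξsq / (2 * d))
    (by positivity : 0 < d * ξsq / 2)).mul_left (d : ℂ)
  have heq := hresidue.unique (hparity.congr_fun fun q => by
    rw [gaussWeight_mul_gaussWeight_sub hd.pos]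
    ring)
  exact_mod_cast heq

theorem sum_norm_sq_amplitude (hd : Odd d) (hξ : 0 < ξsq) (n₀ : ℤ) :
    ∑ k : Idx d, ‖amplitude d ξsq n₀ k‖ ^ 2 = 1 := by
  have hd0 : (0 : ℝ) < d := Nat.cast_pos.mpr hd.pos
  have hnorm := two_mul_sum_theta3_sq hd hξ
  set N := theta3 0 (ξsq / (2 * d)) * theta3 0 (d * ξsq / 2) +
    theta3 (1 / 2) (ξsq / (2 * d)) * theta3 (d / 2) (d * ξsq / 2) with hN
  have hsum : 0 < ∑ k : Idx d, theta3 ((k : ℤ) / d) (ξsq / d) ^ 2 :=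
    Finset.sum_pos (fun k _ => pow_pos (theta3_pos (by positivity) _) 2)
      ⟨wrap hd 0, Finset.mem_univ _⟩
  have hN0 : 0 < N := pos_of_mul_pos_right (hnorm ▸ by positivity : 0 < (d : ℝ) * N) hd0.le
  have hterm (k : Idx d) : ‖amplitude d ξsq n₀ k‖ ^ 2 =
      2 / d / N * theta3 ((k : ℤ) / d) (ξsq / d) ^ 2 := by
    have hphase : Complex.exp (2 * π * Complex.I * n₀ * (k : ℤ) / d) = 𝐞 (n₀ * (k : ℤ) / d) := by
      rw [fourierChar_apply]
      congr 1
      push_cast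
      ring
    rw [amplitude, hphase, norm_mul, Circle.norm_coe, mul_one, Complex.norm_real, norm_eq_abs,
      sq_abs, mul_pow, div_pow, ← hN, sq_sqrt (by positivity), sq_sqrt hN0.le]
  simp only [hterm, ← Finset.mul_sum]
  field_simp
  linarith

theorem sum_norm_sq_sum_smul_timeState (hd : Odd d) (c : Idx d → ℂ) :
    ∑ n, ‖(∑ k, c k • timeState d k) n‖ ^ 2 = ∑ k, ‖c k‖ ^ 2 := by
  have hexpand : ∑ n, conj ((∑ k, c k • timeState d k) n) * (∑ k, c k • timeState d k) n =
      ∑ k, ∑ k', conj (c k) * c k' * ∑ n, timeState d k' n * conj (timeState d k n) := by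
    simp only [Finset.sum_apply, Pi.smul_apply, smul_eq_mul, map_sum, map_mul, Finset.sum_mul_sum]
    simp only [Finset.mul_sum]
    rw [Finset.sum_comm]
    refine Finset.sum_congr rfl fun k _ => ?_
    rw [Finset.sum_comm]
    refine Finset.sum_congr rfl fun k' _ => Finset.sum_congr rfl fun n _ => ?_
    ring
  simp only [sum_timeState_mul_conj hd, mul_ite, mul_one, mul_zero, Finset.sum_ite_eq,
    Finset.mem_univ, if_true, Complex.conj_mul'] at hexpand
  exact_mod_cast hexpand

theorem sum_norm_sq_initialState (hd : Odd d) (hξ : 0 < ξsq) (n₀ : ℤ) :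
    ∑ n, ‖initialState d ξsq n₀ n‖ ^ 2 = 1 := by
  rw [initialState, sum_norm_sq_sum_smul_timeState hd, sum_norm_sq_amplitude hd hξ]

end InitialState

section Outcomes

theorem setIntegral_pi_snoc {J : ℕ} {S : Set ℝ} (hS : IsCompact S) {F : (Fin (J + 1) → ℝ) → ℂ}
    (hF : Continuous F) :
    ∫ x in Set.univ.pi fun _ : Fin (J + 1) => S, F x =
      ∫ x in Set.univ.pi fun _ : Fin J => S, ∫ y in S, F (Fin.snoc (α := fun _ => ℝ) x y) := by
  let e := MeasurableEquiv.piFinSuccAbove (fun _ : Fin (J + 1) => ℝ) (Fin.last J)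
  have he : MeasureTheory.MeasurePreserving e.symm :=
    (MeasureTheory.volume_preserving_piFinSuccAbove (fun _ => ℝ) (Fin.last J)).symm
  have hsnoc (q : ℝ × (Fin J → ℝ)) : e.symm q = Fin.snoc (α := fun _ => ℝ) q.2 q.1 := by
    simp [e, MeasurableEquiv.piFinSuccAbove_symm_apply, Fin.insertNthEquiv, Fin.insertNth_last']
  have hpreimage : e.symm ⁻¹' (Set.univ.pi fun _ => S) = S ×ˢ Set.univ.pi fun _ => S := by
    ext q
    simp [hsnoc, Set.mem_pi, Fin.forall_fin_succ', and_comm]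
  have hcont : Continuous fun q : ℝ × (Fin J → ℝ) => F (Fin.snoc (α := fun _ => ℝ) q.2 q.1) :=
    hF.comp (Continuous.finSnoc (A := fun _ => ℝ) continuous_snd continuous_fst)
  have hint := hcont.continuousOn.integrableOn_compact (μ := MeasureTheory.volume)
    (hS.prod (isCompact_univ_pi fun _ : Fin J => hS))
  rw [MeasureTheory.IntegrableOn, MeasureTheory.Measure.volume_eq_prod,
    ← MeasureTheory.Measure.prod_restrict] at hint
  rw [← he.setIntegral_preimage_emb e.symm.measurableEmbedding, hpreimage]
  simp only [hsnoc]
  rw [MeasureTheory.Measure.volume_eq_prod, ← MeasureTheory.Measure.prod_restrict,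
    MeasureTheory.integral_prod_symm _ hint]

variable {d : ℕ} {σsq : ℝ}

theorem continuous_postState (hd : 0 < d) (ξsq : ℝ) (hσ : 0 < σsq) (δ : ℝ) (n₀ : ℤ) (J : ℕ) :
    Continuous (postState d ξsq σsq δ n₀ J) := by
  induction J with
  | zero => exact continuous_const
  | succ J ih =>
    exact ((continuous_kraus hd hσ).comp (continuous_apply (Fin.last J))).matrix_mulVec
      (continuous_const.matrix_mulVec (ih.comp (by fun_prop)))

theorem postState_snoc (ξsq σsq δ : ℝ) (n₀ : ℤ) (J : ℕ) (x : Fin J → ℝ) (y : ℝ) :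
    postState d ξsq σsq δ n₀ (J + 1) (Fin.snoc (α := fun _ => ℝ) x y) =
      kraus d σsq y *ᵥ (evolution d (δ / √d) *ᵥ postState d ξsq σsq δ n₀ J x) := by
  simp only [postState, Fin.snoc_last, Fin.snoc_castSucc]

theorem outcomeDensity_eq_shiftForm (hd : Odd d) (ξsq σsq δ : ℝ) (n₀ : ℤ) (J : ℕ)
    (x : Fin J → ℝ) :
    (outcomeDensity d ξsq σsq δ n₀ J x : ℂ) =
      shiftForm hd 0 1 (postState d ξsq σsq δ n₀ J x) := by
  rw [outcomeDensity, EuclideanSpace.norm_sq_eq, shiftForm_zero_one]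

theorem outcomeCharacter_eq_integral_shiftForm (hd : Odd d) (ξsq σsq δ : ℝ) (n₀ : ℤ) (J : ℕ)
    (i : Fin J) :
    outcomeCharacter d ξsq σsq δ n₀ J i =
      ∫ x in Set.univ.pi fun _ : Fin J => Set.Icc (-(√d / 2)) (√d / 2),
        𝐞 (x i / √d) * shiftForm hd 0 1 (postState d ξsq σsq δ n₀ J x) := by
  have hphase (x : ℝ) : Complex.exp (2 * π * Complex.I * x / √d) = 𝐞 (x / √d) := by
    rw [fourierChar_apply]
    congr 1
    push_cast
    ring
  simp only [outcomeCharacter, outcomeDensity_eq_shiftForm hd, hphase]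

theorem continuous_shiftForm_postState (hd : Odd d) (ξsq : ℝ) (hσ : 0 < σsq) (δ : ℝ) (n₀ : ℤ)
    (J : ℕ) (a : ℤ) (G : Idx d → ℝ) :
    Continuous fun x => shiftForm hd a G (postState d ξsq σsq δ n₀ J x) :=
  (continuous_shiftForm hd a G).comp (continuous_postState hd.pos ξsq hσ δ n₀ J)

theorem continuous_outcomeIntegrand (hd : Odd d) (ξsq : ℝ) (hσ : 0 < σsq) (δ : ℝ) (n₀ : ℤ)
    (J : ℕ) (i : Fin J) :
    Continuous fun x : Fin J → ℝ =>
      𝐞 (x i / √d) * shiftForm hd 0 1 (postState d ξsq σsq δ n₀ J x) := by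
  have hform := continuous_shiftForm_postState hd ξsq hσ δ n₀ J 0 1
  fun_prop

/-- The Kraus operators resolve the identity, so a later measurement can be integrated out. -/
theorem outcomeCharacter_castSucc (hd : Odd d) (ξsq : ℝ) (hσ : 0 < σsq) (δ : ℝ) (n₀ : ℤ) (J : ℕ)
    (i : Fin J) :
    outcomeCharacter d ξsq σsq δ n₀ (J + 1) i.castSucc =
      outcomeCharacter d ξsq σsq δ n₀ J i := by
  rw [outcomeCharacter_eq_integral_shiftForm hd, outcomeCharacter_eq_integral_shiftForm hd,
    setIntegral_pi_snoc isCompact_Icc (continuous_outcomeIntegrand hd ξsq hσ δ n₀ _ i.castSucc)]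
  simp only [postState_snoc, Fin.snoc_castSucc, MeasureTheory.integral_const_mul,
    integral_shiftForm_kraus hd hσ, shiftForm_zero_evolution,
    Matrix.one_vecMul_of_mem_rowStochastic (jumpMatrix_mem_rowStochastic hd hσ)]

theorem outcomeCharacter_last (hd : Odd d) (ξsq : ℝ) (hσ : 0 < σsq) (δ : ℝ) (n₀ : ℤ) (J : ℕ) :
    outcomeCharacter d ξsq σsq δ n₀ (J + 1) (Fin.last J) =
      outcomeCoeff d σsq 1 * ∫ x in Set.univ.pi fun _ : Fin J => Set.Icc (-(√d / 2)) (√d / 2),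
        shiftForm hd 1 1 (evolution d (δ / √d) *ᵥ postState d ξsq σsq δ n₀ J x) := by
  have hlast (v : Idx d → ℂ) : ∫ y in Set.Icc (-(√d / 2)) (√d / 2),
      𝐞 (y / √d) * shiftForm hd 0 1 (kraus d σsq y *ᵥ v) =
        outcomeCoeff d σsq 1 * shiftForm hd 1 1 v := by
    simpa using integral_fourierChar_mul_shiftForm_kraus hd hσ 1 0 v
  rw [outcomeCharacter_eq_integral_shiftForm hd, setIntegral_pi_snoc isCompact_Icc
    (continuous_outcomeIntegrand hd ξsq hσ δ n₀ (J + 1) (Fin.last J))]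
  simp only [postState_snoc, Fin.snoc_last, hlast, MeasureTheory.integral_const_mul]

/-- Propagating the observable backwards through `J` rounds of evolution and measurement extends
the random walk by `J` jumps. -/
theorem integral_shiftForm_hitFactor_postState (hd : Odd d) (ξsq : ℝ) (hσ : 0 < σsq) (n₀ : ℤ)
    (J k : ℕ) :
    ∫ x in Set.univ.pi fun _ : Fin J => Set.Icc (-(√d / 2)) (√d / 2),
        shiftForm hd 1 (hitFactor (lastLabel hd) 2 *
          hitExpectation (jumpMatrix d σsq) (lastLabel hd) 2 k)
          (postState d ξsq σsq (1 / 2) n₀ J x) =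
      𝐞 (1 / (2 * d)) ^ J * shiftForm hd 1 (hitFactor (lastLabel hd) 2 *
        hitExpectation (jumpMatrix d σsq) (lastLabel hd) 2 (k + J)) (initialState d ξsq n₀) := by
  induction J generalizing k with
  | zero =>
    have huniv : (Set.univ.pi fun _ : Fin 0 => Set.Icc (-(√(d : ℝ) / 2)) (√(d : ℝ) / 2)) =
        Set.univ :=
      Set.eq_univ_of_forall fun _ i => i.elim0
    rw [huniv, MeasureTheory.Measure.restrict_univ, MeasureTheory.volume_pi,
      MeasureTheory.Measure.pi_of_empty, MeasureTheory.integral_dirac]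
    simp only [postState, pow_zero, one_mul, add_zero]
  | succ J ih =>
    rw [setIntegral_pi_snoc isCompact_Icc
      (continuous_shiftForm_postState hd ξsq hσ (1 / 2) n₀ (J + 1) 1 _)]
    simp only [postState_snoc, integral_shiftForm_kraus hd hσ, shiftForm_one_evolution_half,
      MeasureTheory.integral_const_mul]
    rw [← hitExpectation, ih, ← mul_assoc, ← pow_succ', Nat.succ_add_eq_add_succ]

theorem norm_outcomeCharacter_last_le (hd : Odd d) {ξsq M : ℝ} (hξ : 0 < ξsq) (hσ : 0 < σsq)
    (n₀ : ℤ) (J : ℕ)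
    (hM : ∀ p, |hitExpectation (jumpMatrix d σsq) (lastLabel hd) 2 J p| ≤ M) :
    ‖outcomeCharacter d ξsq σsq (1 / 2) n₀ (J + 1) (Fin.last J)‖ ≤ M := by
  have hintegral := integral_shiftForm_hitFactor_postState hd ξsq hσ n₀ J 0
  rw [hitExpectation, mul_one, zero_add] at hintegral
  have hobservable (p : Idx d) : |(hitFactor (lastLabel hd) 2 *
      hitExpectation (jumpMatrix d σsq) (lastLabel hd) 2 J) p| ≤ M := by
    rw [Pi.mul_apply, abs_mul]
    exact (mul_le_of_le_one_left (abs_nonneg _)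
      (abs_hitFactor_le_one _ (Set.right_mem_Icc.mpr zero_le_two) p)).trans (hM p)
  have hform := norm_shiftForm_le hd 1 hobservable (initialState d ξsq n₀)
  rw [sum_norm_sq_initialState hd hξ, mul_one] at hform
  rw [outcomeCharacter_last hd ξsq hσ]
  simp only [shiftForm_one_evolution_half, MeasureTheory.integral_const_mul, mul_one, hintegral,
    norm_mul, norm_pow, Circle.norm_coe, one_pow, one_mul, Complex.norm_real, norm_eq_abs]
  exact (mul_le_of_le_one_left (norm_nonneg _) (abs_outcomeCoeff_le hd.pos hσ 1)).trans hform

theorem norm_outcomeCharacter_le (hd : Odd d) {ξsq M : ℝ} (hξ : 0 < ξsq) (hσ : 0 < σsq) (n₀ : ℤ)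
    (J : ℕ) (i : Fin J)
    (hM : ∀ p, |hitExpectation (jumpMatrix d σsq) (lastLabel hd) 2 i p| ≤ M) :
    ‖outcomeCharacter d ξsq σsq (1 / 2) n₀ J i‖ ≤ M := by
  induction J with
  | zero => exact i.elim0
  | succ J ih =>
    induction i using Fin.lastCases with
    | last => exact norm_outcomeCharacter_last_le hd hξ hσ n₀ J hM
    | cast i =>
      rw [outcomeCharacter_castSucc hd ξsq hσ]
      exact ih i hM

end Outcomes

end

end QuasiIdealClock

theorem mainTheorem2_general {c₂ t β ε : ℝ} (hc₂ : 0 < c₂) (ht : 0 < t) (hβ : β < -(1 / 2))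
    (hε : 0 < ε) :
    (∀ c₃ ∈ Set.Icc (0 : ℝ) 2, ∀ᶠ d : ℕ in atTop, Odd d →
      ∀ n : ℕ, n + 1 = ⌈t * Real.sqrt d⌉₊ → ∀ p₁ : QuasiIdealClock.Idx d,
        QuasiIdealClock.walkExpectation d (c₂ * (d : ℝ) ^ β) n p₁
            (QuasiIdealClock.antipodeProduct d c₃ n)
          ≤ 1 - (1 - ε) * c₃ * (t / Real.sqrt d)) ∧
    (∀ᶠ d : ℕ in atTop, Odd d →
      ∀ ξsq > 0, ∀ (n₀ : ℤ) (J : ℕ) (i : Fin J), (i : ℕ) + 1 = ⌈t * Real.sqrt d⌉₊ →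
        ‖QuasiIdealClock.outcomeCharacter d ξsq (c₂ * (d : ℝ) ^ β) (1 / 2) n₀ J i‖
          ≤ 1 - (1 - ε) * 2 * (t / Real.sqrt d)) := by
  refine ⟨fun c₃ hc₃ =>
    QuasiIdealClock.eventually_walkExpectation_antipodeProduct_le hc₂ ht hβ hc₃ hε, ?_⟩
  filter_upwards [QuasiIdealClock.eventually_abs_hitExpectation_le hc₂ ht hβ
    (Set.right_mem_Icc.mpr zero_le_two) hε] with d hwalk hd ξsq hξ n₀ J i hi
  have hσ : 0 < c₂ * (d : ℝ) ^ β := mul_pos hc₂ (Real.rpow_pos_of_pos (Nat.cast_pos.mpr hd.pos) β)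
  exact QuasiIdealClock.norm_outcomeCharacter_le hd hξ hσ n₀ J i (hwalk hd i hi)

theorem mainTheorem2 (c₂ : ℝ) (hc₂ : 0 < c₂) :
    (∀ c₃ ∈ Set.Icc (0 : ℝ) 2, ∃ c₅ : ℝ, 0 < c₅ ∧
      ∀ t : ℝ, 0 < t → ∀ β : ℝ, β < -(1 / 2) → ∀ ε : ℝ, 0 < ε →
      ∃ g h : ℕ → ℝ,
        g =O[atTop] (fun d : ℕ => (d : ℝ) ^ (3 / 2 : ℝ) *
          Real.exp (-(Real.pi * ε * t / (2 * c₂) * (d : ℝ) ^ (-(1 / 2) - β)))) ∧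
        h =O[atTop] (fun d : ℕ => Real.exp (-(c₅ * (d : ℝ) ^ |(|β| - 1)|))) ∧
        h =o[atTop] (fun _ : ℕ => (1 : ℝ)) ∧
        ∀ᶠ d : ℕ in atTop, Odd d →
          ∀ n : ℕ, n + 1 = ⌈t * Real.sqrt d⌉₊ → ∀ p₁ : QuasiIdealClock.Idx d,
            QuasiIdealClock.walkExpectation d (c₂ * (d : ℝ) ^ β) n p₁
                (QuasiIdealClock.antipodeProduct d c₃ n)
              ≤ 1 - (1 - ε) * c₃ * (t / Real.sqrt d) * (1 + g d + h d)) ∧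
    (∀ t : ℝ, 0 < t → ∀ β : ℝ, β < -(1 / 2) →
      ∀ c₁ : ℝ, 0 < c₁ → ∀ α : ℝ, -1 < α → α < 1 →
      ∃ r : ℕ → ℝ, r =o[atTop] (fun _ : ℕ => (1 : ℝ)) ∧
        ∀ᶠ d : ℕ in atTop, Odd d →
          ∀ (n₀ : ℤ) (J : ℕ) (i : Fin J), (i : ℕ) + 1 = ⌈t * Real.sqrt d⌉₊ →
            ‖QuasiIdealClock.outcomeCharacter d (c₁ * (d : ℝ) ^ α) (c₂ * (d : ℝ) ^ β)
                (1 / 2) n₀ J i‖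
              ≤ 1 - t / Real.sqrt d * (1 + r d)) := by
  refine ⟨fun c₃ hc₃ => ⟨1, one_pos, fun t ht β hβ ε hε => ⟨0, 0, isBigO_zero _ _, isBigO_zero _ _,
    isLittleO_zero _ _, ?_⟩⟩, fun t ht β hβ c₁ hc₁ α _ _ => ⟨0, isLittleO_zero _ _, ?_⟩⟩
  · filter_upwards [(mainTheorem2_general hc₂ ht hβ hε).1 c₃ hc₃] with d hwalk hd n hn p₁
    simpa using hwalk hd n hn p₁
  · filter_upwards [(mainTheorem2_general hc₂ ht hβ one_half_pos).2] with d hcharacter hd n₀ J i hi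
    have hξ : 0 < c₁ * (d : ℝ) ^ α :=
      mul_pos hc₁ (Real.rpow_pos_of_pos (Nat.cast_pos.mpr hd.pos) α)
    refine (hcharacter hd _ hξ n₀ J i hi).trans_eq ?_
    simp only [Pi.zero_apply]
    ring
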